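/- Let $n\ge 2$ be an integer and let $2\le p<n$. Put $p^*=\frac{np}{n-p}$, $p'=\frac{p}{p-1}$ and $$v(x)=\frac{\kappa_0}{(1+|x|^{p'})^{(n-p)/p}},\qquad x\in\mathbb R^n,$$ where $\kappa_0>0$ is the constant for which $\|v\|_{L^{p^*}(\mathbb R^n)}=1$. Let $L^2(\mathbb R^n,v^{p^*-2})$ be the space of (classes of) measurable functions $w:\mathbb R^n\to\mathbb R$ with $\int_{\mathbb R^n}|w|^2v^{p^*-2}<\infty$, with norm $\big(\int_{\mathbb R^n}|w|^2v^{p^*-2}\big)^{1/2}$, and let $X=W^{1,2}_0(\mathbb R^n,v^{p^*-2},|\nabla v|^{p-2})$ be the completion of $C_c^\infty(\mathbb R^n)$ with respect to the norm $$\|g\|_X=\left(\int_{\mathbb R^n}g^2\,v^{p^*-2}+\int_{\mathbb R^n}|\nabla g|^2\,|\nabla v|^{p-2}\right)^{1/2}$$ (with $|\nabla v|^{p-2}\equiv 1$ if $p=2$). Then $X$ embeds compactly into $L^2(\mathbb R^n,v^{p^*-2})$: the inclusion $C_c^\infty(\mathbb R^n)\to L^2(\mathbb R^n,v^{p^*-2})$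 extends to a continuous linear map $\iota:X\to L^2(\mathbb R^n,v^{p^*-2})$, and $\iota$ is injective and compact. -/

import Mathlib

open MeasureTheory
open scoped ContDiff

noncomputable section

/-! ### Sobolev exponents and the extremal function `v` -/

/-- The Sobolev exponent `p* = n p / (n - p)`. -/
def sobolevExp (n : ℕ) (p : ℝ) : ℝ := n * p / (n - p)

/-- The Hölder conjugate exponent `p' = p / (p - 1)`. -/
def conjExp (p : ℝ) : ℝ := p / (p - 1)

/-- The profile `(1 + |x| ^ p') ^ (-(n - p) / p)`, before normalization. -/
def bubbleProfile (n : ℕ) (p : ℝ) (x : EuclideanSpace ℝ (Fin n)) : ℝ :=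
  1 / (1 + ‖x‖ ^ conjExp p) ^ ((n - p) / p)

/-- The normalizing constant: the reciprocal of the `L^{p*}(ℝⁿ)` norm of the profile. -/
def bubbleConst (n : ℕ) (p : ℝ) : ℝ :=
  (eLpNorm (bubbleProfile n p) (ENNReal.ofReal (sobolevExp n p)) volume).toReal⁻¹

/-- The function `v(x) = κ₀ / (1 + |x| ^ p') ^ ((n - p) / p)`, with `κ₀` the constant such that
`‖v‖_{L^{p*}} = 1` (see `eLpNorm_bubble`). -/
def bubble (n : ℕ) (p : ℝ) (x : EuclideanSpace ℝ (Fin n)) : ℝ :=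
  bubbleConst n p * bubbleProfile n p x

theorem one_lt_conjExp {p : ℝ} (hp : 2 ≤ p) : 1 < conjExp p := by
  unfold conjExp
  rw [lt_div_iff₀ (by linarith)]
  linarith

theorem two_le_sobolevExp {n : ℕ} {p : ℝ} (hp : 2 ≤ p) (hpn : p < n) : 2 ≤ sobolevExp n p := by
  unfold sobolevExp
  rw [le_div_iff₀ (by linarith)]
  nlinarith

theorem bubbleConst_nonneg (n : ℕ) (p : ℝ) : 0 ≤ bubbleConst n p :=
  inv_nonneg.2 ENNReal.toReal_nonneg

theorem contDiff_bubbleProfile {n : ℕ} {p : ℝ} (hp : 2 ≤ p) :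
    ContDiff ℝ 1 (bubbleProfile n p) := by
  have hpos : ∀ x : EuclideanSpace ℝ (Fin n), 0 < 1 + ‖x‖ ^ conjExp p := fun x => by positivity
  have h1 : ContDiff ℝ 1 (fun x : EuclideanSpace ℝ (Fin n) => 1 + ‖x‖ ^ conjExp p) :=
    contDiff_const.add (contDiff_norm_rpow (one_lt_conjExp hp))
  exact contDiff_const.div (h1.rpow_const_of_ne fun x => (hpos x).ne')
    fun x => (Real.rpow_pos_of_pos (hpos x) _).ne'

theorem contDiff_bubble {n : ℕ} {p : ℝ} (hp : 2 ≤ p) : ContDiff ℝ 1 (bubble n p) :=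
  contDiff_const.mul (contDiff_bubbleProfile hp)

theorem bubbleProfile_pos (n : ℕ) (p : ℝ) (x : EuclideanSpace ℝ (Fin n)) :
    0 < bubbleProfile n p x := by
  unfold bubbleProfile
  positivity

theorem bubble_nonneg (n : ℕ) (p : ℝ) (x : EuclideanSpace ℝ (Fin n)) : 0 ≤ bubble n p x :=
  mul_nonneg (bubbleConst_nonneg n p) (bubbleProfile_pos n p x).le

/-- The profile belongs to `L^{p*}(ℝⁿ)`. -/
theorem memLp_bubbleProfile {n : ℕ} {p : ℝ} (hp : 2 ≤ p) (hpn : p < n) :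
    MemLp (bubbleProfile n p) (ENNReal.ofReal (sobolevExp n p)) volume := by
  have hq := two_le_sobolevExp hp hpn
  have hp1 := one_lt_conjExp hp
  have hcont := (contDiff_bubbleProfile (n := n) hp).continuous
  rw [← integrable_norm_rpow_iff hcont.aestronglyMeasurable (by simp; linarith) (by simp),
    ENNReal.toReal_ofReal (by linarith)]
  have hn : (0 : ℝ) < n := by linarith
  have hfin : (Module.finrank ℝ (EuclideanSpace ℝ (Fin n)) : ℝ) < n * conjExp p := by
    rw [finrank_euclideanSpace_fin]
    nlinarith
  have hint := (integrable_one_add_norm (μ := (volume : Measure (EuclideanSpace ℝ (Fin n))))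
    hfin).const_mul ((2 : ℝ) ^ ((n : ℝ) * (conjExp p - 1)))
  refine hint.mono' ?_ (Filter.Eventually.of_forall fun x => ?_)
  · exact (hcont.norm.rpow_const fun x => Or.inr (by linarith)).aestronglyMeasurable
  have hx : 0 ≤ ‖x‖ := norm_nonneg x
  have hb : 0 < 1 + ‖x‖ ^ conjExp p := by positivity
  have hb' : 0 < 1 + ‖x‖ := by positivity
  rw [Real.norm_of_nonneg (by positivity), Real.norm_of_nonneg (bubbleProfile_pos n p x).le]
  have e1 : bubbleProfile n p x ^ sobolevExp n p = (1 + ‖x‖ ^ conjExp p) ^ (-(n : ℝ)) := by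
    unfold bubbleProfile
    rw [one_div, ← Real.rpow_neg hb.le, ← Real.rpow_mul hb.le]
    congr 1
    unfold sobolevExp
    have h1 : (n : ℝ) - p ≠ 0 := by linarith
    have h2 : p ≠ 0 := by linarith
    field_simp
  have key : (1 + ‖x‖) ^ conjExp p ≤ 2 ^ (conjExp p - 1) * (1 + ‖x‖ ^ conjExp p) := by
    have h := NNReal.rpow_add_le_mul_rpow_add_rpow 1 ‖x‖₊ hp1.le
    rw [NNReal.one_rpow] at h
    exact_mod_cast h
  rw [e1, Real.rpow_neg hb.le, Real.rpow_neg hb'.le, mul_comm (n : ℝ) (conjExp p),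
    Real.rpow_mul hb'.le, mul_comm (n : ℝ) (conjExp p - 1), Real.rpow_mul (by norm_num)]
  rw [← div_eq_mul_inv, inv_le_comm₀ (by positivity) (by positivity), inv_div,
    div_le_iff₀ (by positivity), mul_comm, ← Real.mul_rpow (by positivity) hb.le]
  exact Real.rpow_le_rpow (by positivity) key hn.le

/-- The function `v` is normalized: `‖v‖_{L^{p*}(ℝⁿ)} = 1`. -/
theorem eLpNorm_bubble {n : ℕ} {p : ℝ} (hp : 2 ≤ p) (hpn : p < n) :
    eLpNorm (bubble n p) (ENNReal.ofReal (sobolevExp n p)) volume = 1 := by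
  have hq := two_le_sobolevExp hp hpn
  have hmem := memLp_bubbleProfile hp hpn
  have hne : eLpNorm (bubbleProfile n p) (ENNReal.ofReal (sobolevExp n p)) volume ≠ 0 := by
    rw [Ne, eLpNorm_eq_zero_iff hmem.1 (by simp; linarith)]
    intro h
    have h2 := (contDiff_bubbleProfile (n := n) hp).continuous.ae_eq_iff_eq volume
      continuous_zero |>.1 h
    exact (bubbleProfile_pos n p 0).ne' (congrFun h2 0)
  have e : bubble n p = bubbleConst n p • bubbleProfile n p := rfl
  rw [e, eLpNorm_const_smul, Real.enorm_of_nonneg (bubbleConst_nonneg n p), bubbleConst,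
    ENNReal.ofReal_inv_of_pos (ENNReal.toReal_pos hne hmem.2.ne), ENNReal.ofReal_toReal hmem.2.ne]
  exact ENNReal.inv_mul_cancel hne hmem.2.ne

/-! ### Weighted spaces -/

/-- A weight on `ℝⁿ`: a nonnegative, locally integrable function. -/
structure Weight (n : ℕ) where
  /-- The underlying function. -/
  toFun : EuclideanSpace ℝ (Fin n) → ℝ
  nonneg : ∀ x, 0 ≤ toFun x
  locallyIntegrable : LocallyIntegrable toFun volume

/-- The measure `ω(x) dx`. -/
def Weight.measure {n : ℕ} (w : Weight n) : Measure (EuclideanSpace ℝ (Fin n)) :=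
  volume.withDensity fun x => ENNReal.ofReal (w.toFun x)

/-- The weighted space `L²(ℝⁿ, ω)`, with norm `(∫ |f|² ω)^{1/2}`. -/
abbrev WeightedL2 {n : ℕ} (w : Weight n) : Type := Lp ℝ 2 w.measure

/-- The space `C_c^∞(ℝⁿ)` of real test functions on `ℝⁿ`, tagged with two weights so that it can
carry the corresponding weighted Sobolev norm. -/
def WeightedTest {n : ℕ} (_w₀ _w₁ : Weight n) : Type :=
  TestFunction (⊤ : TopologicalSpace.Opens (EuclideanSpace ℝ (Fin n))) ℝ (⊤ : ℕ∞)

namespace WeightedTest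

variable {n : ℕ} {w₀ w₁ : Weight n}

instance : AddCommGroup (WeightedTest w₀ w₁) :=
  inferInstanceAs (AddCommGroup
    (TestFunction (⊤ : TopologicalSpace.Opens (EuclideanSpace ℝ (Fin n))) ℝ (⊤ : ℕ∞)))

instance : Module ℝ (WeightedTest w₀ w₁) :=
  inferInstanceAs (Module ℝ
    (TestFunction (⊤ : TopologicalSpace.Opens (EuclideanSpace ℝ (Fin n))) ℝ (⊤ : ℕ∞)))

/-- The function underlying a test function. -/
def fn (φ : WeightedTest w₀ w₁) : EuclideanSpace ℝ (Fin n) → ℝ := TestFunction.toFun φ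

theorem contDiff_fn (φ : WeightedTest w₀ w₁) : ContDiff ℝ ∞ φ.fn := TestFunction.contDiff' φ

theorem hasCompactSupport_fn (φ : WeightedTest w₀ w₁) : HasCompactSupport φ.fn :=
  TestFunction.hasCompactSupport' φ

theorem fn_add (φ ψ : WeightedTest w₀ w₁) : (φ + ψ).fn = φ.fn + ψ.fn := rfl

theorem fn_smul (c : ℝ) (φ : WeightedTest w₀ w₁) : (c • φ).fn = c • φ.fn := rfl

theorem differentiable_fn (φ : WeightedTest w₀ w₁) : Differentiable ℝ φ.fn :=
  φ.contDiff_fn.differentiable (by simp)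

theorem gradient_add (φ ψ : WeightedTest w₀ w₁) (x : EuclideanSpace ℝ (Fin n)) :
    gradient (φ + ψ).fn x = gradient φ.fn x + gradient ψ.fn x := by
  unfold gradient
  rw [fn_add, fderiv_add (φ.differentiable_fn x) (ψ.differentiable_fn x), map_add]

theorem gradient_smul (c : ℝ) (φ : WeightedTest w₀ w₁) (x : EuclideanSpace ℝ (Fin n)) :
    gradient (c • φ).fn x = c • gradient φ.fn x := by
  unfold gradient
  rw [fn_smul, fderiv_const_smul (φ.differentiable_fn x), map_smul]

theorem continuous_gradient (φ : WeightedTest w₀ w₁) : Continuous (gradient φ.fn) :=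
  (LinearIsometryEquiv.continuous _).comp (φ.contDiff_fn.continuous_fderiv (by simp))

theorem hasCompactSupport_gradient (φ : WeightedTest w₀ w₁) :
    HasCompactSupport (gradient φ.fn) :=
  (φ.hasCompactSupport_fn.fderiv (𝕜 := ℝ)).comp_left (map_zero _)

/-- The inner product `∫ φ ψ ω₀ + ∫ ∇φ · ∇ψ ω₁`. -/
def ip (φ ψ : WeightedTest w₀ w₁) : ℝ :=
  (∫ x, φ.fn x * ψ.fn x * w₀.toFun x) +
    ∫ x, inner ℝ (gradient φ.fn x) (gradient ψ.fn x) * w₁.toFun x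

theorem integrable_left (φ ψ : WeightedTest w₀ w₁) :
    Integrable (fun x => φ.fn x * ψ.fn x * w₀.toFun x) volume :=
  w₀.locallyIntegrable.integrable_smul_left_of_hasCompactSupport
    (g := fun x => φ.fn x * ψ.fn x)
    (φ.contDiff_fn.continuous.mul ψ.contDiff_fn.continuous) φ.hasCompactSupport_fn.mul_right

theorem integrable_right (φ ψ : WeightedTest w₀ w₁) :
    Integrable (fun x => inner ℝ (gradient φ.fn x) (gradient ψ.fn x) * w₁.toFun x) volume :=
  w₁.locallyIntegrable.integrable_smul_left_of_hasCompactSupport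
    (g := fun x => inner ℝ (gradient φ.fn x) (gradient ψ.fn x))
    (φ.continuous_gradient.inner ψ.continuous_gradient)
    (φ.hasCompactSupport_gradient.mono fun x hx h => hx (by simp [h]))

/-- The semi-inner product structure on `C_c^∞(ℝⁿ)` given by `ip`. -/
@[reducible] def core (w₀ w₁ : Weight n) : PreInnerProductSpace.Core ℝ (WeightedTest w₀ w₁) where
  inner := ip
  conj_inner_symm φ ψ := by
    simp only [ip, conj_trivial, mul_comm (ψ.fn _), real_inner_comm]
  re_inner_nonneg φ := by
    refine add_nonneg (integral_nonneg fun x => ?_) (integral_nonneg fun x => ?_)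
    · exact mul_nonneg (mul_self_nonneg _) (w₀.nonneg x)
    · exact mul_nonneg real_inner_self_nonneg (w₁.nonneg x)
  add_left φ ψ χ := by
    simp only [ip, gradient_add]
    simp only [fn_add, Pi.add_apply, add_mul, inner_add_left]
    rw [integral_add (integrable_left φ χ) (integrable_left ψ χ),
      integral_add (integrable_right φ χ) (integrable_right ψ χ)]
    ring
  smul_left φ ψ c := by
    simp only [ip, gradient_smul]
    simp only [fn_smul, Pi.smul_apply, smul_eq_mul, mul_assoc,
      real_inner_smul_left, conj_trivial, integral_const_mul]
    ring

/-- `C_c^∞(ℝⁿ)` with the norm `(∫ φ² ω₀ + ∫ |∇φ|² ω₁)^{1/2}` (see `norm_eq`). -/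
instance : SeminormedAddCommGroup (WeightedTest w₀ w₁) :=
  @InnerProductSpace.Core.toSeminormedAddCommGroup ℝ _ _ _ _ (core w₀ w₁)

instance : InnerProductSpace ℝ (WeightedTest w₀ w₁) := InnerProductSpace.ofCore (core w₀ w₁)

theorem norm_eq (φ : WeightedTest w₀ w₁) :
    ‖φ‖ = √((∫ x, φ.fn x ^ 2 * w₀.toFun x) + ∫ x, ‖gradient φ.fn x‖ ^ 2 * w₁.toFun x) := by
  simp only [← real_inner_self_eq_norm_sq, pow_two (φ.fn _)]
  rfl

end WeightedTest

/-- The weighted Sobolev space `W₀^{1,2}(ℝⁿ, ω₀, ω₁)`: the completion of `C_c^∞(ℝⁿ)` in the norm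
`(∫ φ² ω₀ + ∫ |∇φ|² ω₁)^{1/2}`. -/
abbrev WeightedSobolevZero {n : ℕ} (w₀ w₁ : Weight n) : Type :=
  UniformSpace.Completion (WeightedTest w₀ w₁)

/-! ### The two weights built from `v` -/

/-- The weight `v ^ (p* - 2)`. -/
def bubbleWeight {n : ℕ} {p : ℝ} (hp : 2 ≤ p) (hpn : p < n) : Weight n where
  toFun x := bubble n p x ^ (sobolevExp n p - 2)
  nonneg x := Real.rpow_nonneg (bubble_nonneg n p x) _
  locallyIntegrable := ((contDiff_bubble hp).continuous.rpow_const fun _ =>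
    Or.inr (by linarith [two_le_sobolevExp hp hpn])).locallyIntegrable

/-- The weight `|∇v| ^ (p - 2)` (the constant `1` if `p = 2`). -/
def bubbleGradWeight {n : ℕ} {p : ℝ} (hp : 2 ≤ p) : Weight n where
  toFun x := ‖gradient (bubble n p) x‖ ^ (p - 2)
  nonneg x := by positivity
  locallyIntegrable := by
    have h : Continuous (gradient (bubble n p)) :=
      (LinearIsometryEquiv.continuous _).comp ((contDiff_bubble hp).continuous_fderiv (by simp))
    exact (h.norm.rpow_const fun _ => Or.inr (by linarith)).locallyIntegrable

end

/-!
Write `θ = p'` and `m = n (p - 2) / p`. Up to positive constants the two weights are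
`ω₀ = v ^ (p* - 2) = (1 + |x| ^ θ) ^ (-m - 2)` and
`ω₁ = |∇v| ^ (p - 2) = |x| ^ (2 - θ) (1 + |x| ^ θ) ^ (-m)`. Both are continuous, `ω₀` is positive
everywhere and `ω₁` is positive off the origin.

*Tails.* Integrating the divergence of `g² (ω₁ / |x|²) x`, with `|x|` regularized at the origin,
gives the Hardy inequality `∫ g² ω₁ / |x|² ≤ C ∫ |∇g|² ω₁`
(`integral_sq_mul_hardyWeight_le`); its constant is finite because
`n - θ - m θ = (n - p) / (p - 1) > 0`. Since `ω₀ |x|² / ω₁ = |x| ^ θ (1 + |x| ^ θ) ^ (-2)` tends to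
`0` both at the origin and at infinity, the mass `∫ g² ω₀` outside the annulus `δ ≤ |x| ≤ 1 / δ` is
uniformly small on the unit ball of the Sobolev norm (`exists_tail_le`).

*Compactness.* In a neighbourhood of the annulus the weights are bounded above and below, so the
Poincaré inequality on small cubes (`exists_lintegral_gridCube_sq_sub_le`) approximates test
functions in `L²(ω₀)` by step functions on a fixed finite family of cubes. Hence the embedding is a
norm limit of finite-rank operators (`WeightedSobolevZero.isCompactOperator_toL2`).

*Injectivity.* The completion embeds isometrically into `L²(ω₀) × L²(ω₁)` through the inclusion and
the weak gradient. If the first component vanishes, integration by parts against test functions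
supported off the origin shows that so does the second
(`WeightedSobolevZero.toL2_injective`).
-/

noncomputable section

/-! ### Preliminaries on integrals -/

/-- The dilation form of the divergence theorem: `div (u x) = n u + x · ∇u` has integral `0`. -/
theorem integral_fderiv_apply_self {n : ℕ} {u : EuclideanSpace ℝ (Fin n) → ℝ}
    (hu : ContDiff ℝ 1 u) (hc : HasCompactSupport u) :
    ∫ x, fderiv ℝ u x x = -(n * ∫ x, u x) := by
  have hcont : Continuous (fderiv ℝ u) := hu.continuous_fderiv (by simp)
  have hcf : HasCompactSupport (fderiv ℝ u) := hc.fderiv (𝕜 := ℝ)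
  have hproj : ∀ i : Fin n, Continuous fun x : EuclideanSpace ℝ (Fin n) => x i := fun i =>
    (EuclideanSpace.proj (𝕜 := ℝ) i).continuous
  have hint : ∀ i : Fin n, Integrable (fun x : EuclideanSpace ℝ (Fin n) =>
      x i * fderiv ℝ u x (EuclideanSpace.single i 1)) volume := fun i =>
    ((hproj i).mul (hcont.clm_apply continuous_const)).integrable_of_hasCompactSupport
      (hcf.mono fun x hx h => hx (by simp [h]))
  have hsum : ∀ x : EuclideanSpace ℝ (Fin n),
      fderiv ℝ u x x = ∑ i, x i * fderiv ℝ u x (EuclideanSpace.single i 1) := by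
    intro x
    generalize fderiv ℝ u x = L
    conv_lhs => rw [← (EuclideanSpace.basisFun (Fin n) ℝ).sum_repr x]
    simp [map_sum]
  simp_rw [hsum]
  rw [integral_finsetSum _ fun i _ => hint i]
  have hi : ∀ i : Fin n, ∫ x : EuclideanSpace ℝ (Fin n),
      x i * fderiv ℝ u x (EuclideanSpace.single i 1) = - ∫ x, u x := by
    intro i
    have hd : ∀ x : EuclideanSpace ℝ (Fin n),
        fderiv ℝ (fun y : EuclideanSpace ℝ (Fin n) => y i) x (EuclideanSpace.single i 1) = 1 := by
      intro x
      rw [show (fun y : EuclideanSpace ℝ (Fin n) => y i)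
        = (EuclideanSpace.proj (𝕜 := ℝ) i : EuclideanSpace ℝ (Fin n) →L[ℝ] ℝ) from rfl,
        ContinuousLinearMap.fderiv]
      simp
    have huint := hu.continuous.integrable_of_hasCompactSupport (μ := volume) hc
    have := integral_mul_fderiv_eq_neg_fderiv_mul_of_integrable (μ := volume)
      (f := fun x : EuclideanSpace ℝ (Fin n) => x i) (g := u) (v := EuclideanSpace.single i 1)
      (by simpa [hd] using huint) (hint i)
      (((hproj i).mul hu.continuous).integrable_of_hasCompactSupport hc.mul_left)
      (fun x _ => (EuclideanSpace.proj (𝕜 := ℝ) i).differentiableAt)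
      (fun x _ => hu.differentiable (by simp) x)
    simpa [hd] using this
  simp [hi]

/-- The Cauchy–Schwarz inequality against the constant `1` on `[0, 1]`. -/
theorem sq_intervalIntegral_le {f : ℝ → ℝ} (hf : Continuous f) :
    (∫ t in (0 : ℝ)..1, f t) ^ 2 ≤ ∫ t in (0 : ℝ)..1, f t ^ 2 := by
  set I := ∫ t in (0 : ℝ)..1, f t with hI
  -- The variance of `f` is nonnegative.
  have h0 : 0 ≤ ∫ t in (0 : ℝ)..1, (f t - I) ^ 2 :=
    intervalIntegral.integral_nonneg (by norm_num) fun t _ => sq_nonneg _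
  have h1 : ∫ t in (0 : ℝ)..1, (f t - I) ^ 2 = (∫ t in (0 : ℝ)..1, f t ^ 2) - I ^ 2 := by
    have : ∀ t, (f t - I) ^ 2 = f t ^ 2 - (2 * I) * f t + I ^ 2 := fun t => by ring
    simp_rw [this]
    rw [intervalIntegral.integral_add, intervalIntegral.integral_sub,
      intervalIntegral.integral_const_mul, ← hI]
    · simp; ring
    all_goals exact Continuous.intervalIntegrable (by fun_prop) _ _
  linarith

/-! ### Poincaré inequality on convex sets -/

section Poincare

variable {E : Type*} [NormedAddCommGroup E] [InnerProductSpace ℝ E] [FiniteDimensional ℝ E]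

theorem ofReal_sq_sub_le_lintegral {g : E → ℝ} (hg : ContDiff ℝ 1 g) (x y : E) :
    ENNReal.ofReal ((g (x + y) - g x) ^ 2) ≤ ENNReal.ofReal (‖y‖ ^ 2) *
      ∫⁻ t in Set.Ioc (0 : ℝ) 1, ENNReal.ofReal (‖gradient g (x + t • y)‖ ^ 2) := by
  have hfd : Continuous (fderiv ℝ g) := hg.continuous_fderiv (by simp)
  have hgr : Continuous (gradient g) := (LinearIsometryEquiv.continuous _).comp hfd
  have hderiv : ∀ t : ℝ, HasDerivAt (fun t : ℝ => g (x + t • y)) (fderiv ℝ g (x + t • y) y) t := by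
    intro t
    have h1 : HasDerivAt (fun t : ℝ => x + t • y) y t := by
      simpa using ((hasDerivAt_id t).smul_const y).const_add x
    exact ((hg.differentiable (by simp)) (x + t • y)).hasFDerivAt.comp_hasDerivAt t h1
  have hline : Continuous fun t : ℝ => x + t • y := by fun_prop
  have hcont : Continuous fun t : ℝ => fderiv ℝ g (x + t • y) y :=
    (hfd.comp hline).clm_apply continuous_const
  have hftc : ∫ t in (0 : ℝ)..1, fderiv ℝ g (x + t • y) y = g (x + y) - g x := by
    rw [intervalIntegral.integral_eq_sub_of_hasDerivAt (fun t _ => hderiv t)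
      (hcont.intervalIntegrable _ _)]
    simp
  have hcont2 : Continuous fun t : ℝ => ‖gradient g (x + t • y)‖ ^ 2 :=
    ((hgr.comp hline).norm.pow 2)
  have hle : (g (x + y) - g x) ^ 2 ≤
      ‖y‖ ^ 2 * ∫ t in (0 : ℝ)..1, ‖gradient g (x + t • y)‖ ^ 2 := by
    rw [← hftc, ← intervalIntegral.integral_const_mul]
    refine (sq_intervalIntegral_le hcont).trans ?_
    refine intervalIntegral.integral_mono_on (by norm_num)
      ((hcont.pow 2).intervalIntegrable _ _)
      ((continuous_const.mul hcont2).intervalIntegrable _ _) fun t _ => ?_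
    have h2 : |fderiv ℝ g (x + t • y) y| ≤ ‖gradient g (x + t • y)‖ * ‖y‖ := by
      have := (fderiv ℝ g (x + t • y)).le_opNorm y
      unfold gradient
      rwa [LinearIsometryEquiv.norm_map]
    rw [← sq_abs, mul_comm, ← mul_pow]
    gcongr
  refine (ENNReal.ofReal_le_ofReal hle).trans_eq ?_
  rw [ENNReal.ofReal_mul (by positivity), intervalIntegral.integral_of_le (by norm_num),
    ofReal_integral_eq_lintegral_ofReal]
  · exact (hcont2.integrableOn_Icc).mono_set Set.Ioc_subset_Icc_self
  · exact Filter.Eventually.of_forall fun t => by positivity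

variable [MeasurableSpace E] [BorelSpace E]

/-- The `L²` norm of a difference quotient is at most that of the gradient. By convexity the segment
from `x` to `x + y` stays in `Q`, and each of its points is a translate of `x`, so that translation
invariance of `μ` removes the parameter of the segment. -/
theorem lintegral_sq_translate_sub_le {g : E → ℝ} (hg : ContDiff ℝ 1 g) {Q : Set E}
    (hQ : Convex ℝ Q) (hQm : MeasurableSet Q) (μ : Measure E) [μ.IsAddHaarMeasure] (y : E) :
    ∫⁻ x, Q.indicator 1 x * Q.indicator 1 (x + y) * ENNReal.ofReal ((g (x + y) - g x) ^ 2) ∂μ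
      ≤ ENNReal.ofReal (‖y‖ ^ 2) * ∫⁻ x in Q, ENNReal.ofReal (‖gradient g x‖ ^ 2) ∂μ := by
  have hfd : Continuous (fderiv ℝ g) := hg.continuous_fderiv (by simp)
  have hgr : Continuous (gradient g) := (LinearIsometryEquiv.continuous _).comp hfd
  have hG : Measurable fun x => ENNReal.ofReal (‖gradient g x‖ ^ 2) :=
    (hgr.norm.pow 2).measurable.ennreal_ofReal
  set H : E → ENNReal := Q.indicator fun x => ENNReal.ofReal (‖gradient g x‖ ^ 2) with hH
  have hHm : Measurable H := hG.indicator hQm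
  have hpt : ∀ x, Q.indicator (1 : E → ENNReal) x * Q.indicator 1 (x + y) *
      ENNReal.ofReal ((g (x + y) - g x) ^ 2) ≤
      ENNReal.ofReal (‖y‖ ^ 2) * ∫⁻ t in Set.Ioc (0 : ℝ) 1, H (x + t • y) := by
    intro x
    by_cases h : x ∈ Q ∧ x + y ∈ Q
    · simp only [Set.indicator_of_mem h.1, Set.indicator_of_mem h.2, Pi.one_apply, one_mul]
      refine (ofReal_sq_sub_le_lintegral hg x y).trans_eq ?_
      congr 1
      refine setLIntegral_congr_fun measurableSet_Ioc fun t ht => ?_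
      have : x + t • y ∈ Q := hQ.add_smul_mem h.1 h.2 ⟨ht.1.le, ht.2⟩
      simp [hH, Set.indicator_of_mem this]
    · have : Q.indicator (1 : E → ENNReal) x * Q.indicator 1 (x + y) = 0 := by
        by_cases hx : x ∈ Q
        · have : x + y ∉ Q := fun h' => h ⟨hx, h'⟩
          simp [this]
        · simp [hx]
      simp [this]
  refine (lintegral_mono hpt).trans ?_
  have hjm : Measurable fun z : E × ℝ => H (z.1 + z.2 • y) := hHm.comp (by fun_prop)
  rw [lintegral_const_mul _ hjm.lintegral_prod_right', lintegral_lintegral_swap hjm.aemeasurable]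
  simp_rw [lintegral_add_right_eq_self H]
  simp [hH, lintegral_indicator hQm]

/-- A Poincaré inequality on a convex set `Q`, where `D` contains the differences of points of `Q`.
The constant `a` is a value `g z` at a point `z` for which `∫_Q (g - g z)²` does not exceed its
mean over `z ∈ Q`. -/
theorem exists_lintegral_sq_sub_le {g : E → ℝ} (hg : ContDiff ℝ 1 g) {Q D : Set E}
    (hQ : Convex ℝ Q) (hQm : MeasurableSet Q) (hD : MeasurableSet D) (μ : Measure E)
    [μ.IsAddHaarMeasure] (hQ0 : μ Q ≠ 0) (hQt : μ Q ≠ ⊤) {d : ℝ}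
    (hQD : ∀ x ∈ Q, ∀ y, x + y ∈ Q → y ∈ D) (hd : ∀ y ∈ D, ‖y‖ ≤ d) :
    ∃ a : ℝ, ∫⁻ x in Q, ENNReal.ofReal ((g x - a) ^ 2) ∂μ ≤
      μ D / μ Q * ENNReal.ofReal (d ^ 2) *
        ∫⁻ x in Q, ENNReal.ofReal (‖gradient g x‖ ^ 2) ∂μ := by
  set I := ∫⁻ x in Q, ENNReal.ofReal (‖gradient g x‖ ^ 2) ∂μ
  have hgc := hg.continuous
  have hpair : ∫⁻ z in Q, ∫⁻ x in Q, ENNReal.ofReal ((g x - g z) ^ 2) ∂μ ∂μ ≤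
      μ D * (ENNReal.ofReal (d ^ 2) * I) := by
    have h1 : ∀ z, ∫⁻ x in Q, ENNReal.ofReal ((g x - g z) ^ 2) ∂μ =
        ∫⁻ y, Q.indicator 1 (z + y) * ENNReal.ofReal ((g (z + y) - g z) ^ 2) ∂μ := by
      intro z
      rw [← lintegral_indicator hQm, ← lintegral_add_left_eq_self _ z]
      refine lintegral_congr fun y => ?_
      by_cases h : z + y ∈ Q <;> simp [h]
    have hind : Measurable (Q.indicator (1 : E → ENNReal)) := measurable_one.indicator hQm
    have hjm : Measurable fun w : E × E => Q.indicator 1 w.1 * Q.indicator 1 (w.1 + w.2) *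
        ENNReal.ofReal ((g (w.1 + w.2) - g w.1) ^ 2) := by
      refine ((hind.comp measurable_fst).mul (hind.comp (by fun_prop))).mul ?_
      exact Measurable.ennreal_ofReal (Continuous.measurable (by fun_prop))
    calc ∫⁻ z in Q, ∫⁻ x in Q, ENNReal.ofReal ((g x - g z) ^ 2) ∂μ ∂μ
        = ∫⁻ z, ∫⁻ y, Q.indicator 1 z * Q.indicator 1 (z + y) *
            ENNReal.ofReal ((g (z + y) - g z) ^ 2) ∂μ ∂μ := by
          rw [← lintegral_indicator hQm]
          refine lintegral_congr fun z => ?_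
          by_cases h : z ∈ Q
          · simp [h, h1]
          · simp [h]
      _ = ∫⁻ y, ∫⁻ z, Q.indicator 1 z * Q.indicator 1 (z + y) *
            ENNReal.ofReal ((g (z + y) - g z) ^ 2) ∂μ ∂μ :=
          lintegral_lintegral_swap hjm.aemeasurable
      _ ≤ ∫⁻ y, D.indicator (fun _ => ENNReal.ofReal (d ^ 2) * I) y ∂μ := by
          refine lintegral_mono fun y => ?_
          by_cases hy : y ∈ D
          · rw [Set.indicator_of_mem hy]
            refine (lintegral_sq_translate_sub_le hg hQ hQm μ y).trans ?_
            gcongr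
            exact hd y hy
          · rw [Set.indicator_of_notMem hy, nonpos_iff_eq_zero]
            refine (lintegral_congr fun z => ?_).trans lintegral_zero
            by_cases hz : z ∈ Q
            · have : z + y ∉ Q := fun h => hy (hQD z hz y h)
              simp [this]
            · simp [hz]
      _ = μ D * (ENNReal.ofReal (d ^ 2) * I) := by
          rw [lintegral_indicator hD, setLIntegral_const, mul_comm]
  have hm : Measurable fun z => ∫⁻ x in Q, ENNReal.ofReal ((g x - g z) ^ 2) ∂μ := by
    refine Measurable.lintegral_prod_right' (ν := μ.restrict Q)
      (f := fun w : E × E => ENNReal.ofReal ((g w.2 - g w.1) ^ 2)) ?_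
    exact Measurable.ennreal_ofReal (Continuous.measurable (by fun_prop))
  obtain ⟨z, -, hz⟩ := exists_le_setLAverage hQ0 hQt hm.aemeasurable
  refine ⟨g z, hz.trans ?_⟩
  rw [setLAverage_eq, mul_assoc, ENNReal.div_eq_inv_mul, ENNReal.div_eq_inv_mul, mul_assoc]
  gcongr

end Poincare

/-! ### Grids of cubes -/

section Cubes

variable {n : ℕ}

/-- The half-open cube of side `h` with lower corner `h z`, for `z ∈ ℤⁿ`. For `h > 0` these cubes
partition `ℝⁿ`. -/
def gridCube (h : ℝ) (z : Fin n → ℤ) : Set (EuclideanSpace ℝ (Fin n)) :=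
  {x | ∀ i, x i ∈ Set.Ico (z i * h) (z i * h + h)}

theorem convex_gridCube (h : ℝ) (z : Fin n → ℤ) : Convex ℝ (gridCube h z) := by
  have : gridCube h z = ⋂ i, (EuclideanSpace.proj (𝕜 := ℝ) i : EuclideanSpace ℝ (Fin n) →L[ℝ] ℝ) ⁻¹'
      Set.Ico (z i * h) (z i * h + h) := by
    ext x; simp [gridCube]
  rw [this]
  exact convex_iInter fun i => (convex_Ico _ _).linear_preimage
    (EuclideanSpace.proj (𝕜 := ℝ) i : EuclideanSpace ℝ (Fin n) →L[ℝ] ℝ).toLinearMap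

theorem euclidean_box_eq (s : Fin n → Set ℝ) : {x : EuclideanSpace ℝ (Fin n) | ∀ i, x i ∈ s i} =
    (MeasurableEquiv.toLp 2 (Fin n → ℝ)).symm ⁻¹' Set.univ.pi s := by
  ext x; simp [Set.mem_pi]

theorem measurableSet_euclidean_box {s : Fin n → Set ℝ} (hs : ∀ i, MeasurableSet (s i)) :
    MeasurableSet {x : EuclideanSpace ℝ (Fin n) | ∀ i, x i ∈ s i} := by
  rw [euclidean_box_eq]
  exact (MeasurableEquiv.measurable _) (MeasurableSet.univ_pi hs)

theorem volume_euclidean_box {s : Fin n → Set ℝ} (hs : ∀ i, MeasurableSet (s i)) :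
    volume {x : EuclideanSpace ℝ (Fin n) | ∀ i, x i ∈ s i} = ∏ i, volume (s i) := by
  rw [euclidean_box_eq, (EuclideanSpace.volume_preserving_symm_measurableEquiv_toLp
    (Fin n)).measure_preimage (MeasurableSet.univ_pi hs).nullMeasurableSet, volume_pi_pi]

theorem measurableSet_gridCube (h : ℝ) (z : Fin n → ℤ) : MeasurableSet (gridCube h z) :=
  measurableSet_euclidean_box fun _ => measurableSet_Ico

theorem volume_gridCube (h : ℝ) (z : Fin n → ℤ) :
    volume (gridCube h z) = ENNReal.ofReal h ^ n := by
  rw [gridCube, volume_euclidean_box fun _ => measurableSet_Ico]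
  simp

theorem norm_le_of_forall_abs_le {h : ℝ} {y : EuclideanSpace ℝ (Fin n)}
    (hy : ∀ i, |y i| ≤ h) : ‖y‖ ≤ √n * h := by
  rcases Nat.eq_zero_or_pos n with rfl | hn
  · simp [Subsingleton.elim y 0]
  have hh : 0 ≤ h := (abs_nonneg _).trans (hy ⟨0, hn⟩)
  rw [EuclideanSpace.norm_eq, ← Real.sqrt_sq hh, ← Real.sqrt_mul (by positivity)]
  refine Real.sqrt_le_sqrt ?_
  calc ∑ i, ‖y i‖ ^ 2 ≤ ∑ _i : Fin n, h ^ 2 := Finset.sum_le_sum fun i _ => by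
        rw [Real.norm_eq_abs]; gcongr; exact hy i
    _ = n * h ^ 2 := by simp

theorem abs_sub_le_of_mem_gridCube {h : ℝ} {z : Fin n → ℤ} {x y : EuclideanSpace ℝ (Fin n)}
    (hx : x ∈ gridCube h z) (hy : y ∈ gridCube h z) (i : Fin n) : |x i - y i| ≤ h := by
  have h1 := hx i
  have h2 := hy i
  rw [abs_le]
  constructor <;> linarith [h1.1, h1.2, h2.1, h2.2]

theorem dist_le_of_mem_gridCube {h : ℝ} {z : Fin n → ℤ} {x y : EuclideanSpace ℝ (Fin n)}
    (hx : x ∈ gridCube h z) (hy : y ∈ gridCube h z) : dist x y ≤ √n * h := by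
  rw [dist_eq_norm]
  exact norm_le_of_forall_abs_le fun i => by simpa using abs_sub_le_of_mem_gridCube hx hy i

/-- The Poincaré inequality on a cube of side `h`. The factor `2 ^ n` is the ratio of the volumes of
the cube of differences and of the cube itself. -/
theorem exists_lintegral_gridCube_sq_sub_le {g : EuclideanSpace ℝ (Fin n) → ℝ}
    (hg : ContDiff ℝ 1 g) {h : ℝ} (hh : 0 < h) (z : Fin n → ℤ) :
    ∃ a : ℝ, ∫⁻ x in gridCube h z, ENNReal.ofReal ((g x - a) ^ 2) ≤
      ENNReal.ofReal (2 ^ n * (n * h ^ 2)) *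
        ∫⁻ x in gridCube h z, ENNReal.ofReal (‖gradient g x‖ ^ 2) := by
  set D := {y : EuclideanSpace ℝ (Fin n) | ∀ i, y i ∈ Set.Icc (-h) h}
  have hDv : volume D = ENNReal.ofReal (2 * h) ^ n := by
    rw [volume_euclidean_box fun _ => measurableSet_Icc]
    simp [two_mul]
  have hpos : ENNReal.ofReal h ≠ 0 := by simpa using hh
  obtain ⟨a, ha⟩ := exists_lintegral_sq_sub_le hg (convex_gridCube h z)
    (measurableSet_gridCube h z) (measurableSet_euclidean_box fun _ => measurableSet_Icc :
      MeasurableSet D) volume (by rw [volume_gridCube]; exact pow_ne_zero _ hpos)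
    (by rw [volume_gridCube]; finiteness) (d := √n * h)
    (fun x hx y hxy i => by
      simpa [abs_le] using abs_sub_le_of_mem_gridCube hxy hx i)
    (fun y hy => norm_le_of_forall_abs_le fun i => abs_le.2 (hy i))
  refine ⟨a, ha.trans_eq ?_⟩
  congr 1
  rw [hDv, volume_gridCube, ← ENNReal.ofReal_pow (by positivity), ← ENNReal.ofReal_pow hh.le,
    ← ENNReal.ofReal_div_of_pos (by positivity), ← ENNReal.ofReal_mul (by positivity)]
  congr 1
  rw [mul_pow, mul_pow, Real.sq_sqrt (by positivity)]
  field_simp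

theorem pairwise_disjoint_gridCube {h : ℝ} (hh : 0 < h) :
    Pairwise (Function.onFun Disjoint (gridCube (n := n) h)) := by
  intro z w hzw
  rw [Function.onFun, Set.disjoint_left]
  intro x hx hx'
  refine hzw (funext fun i => ?_)
  have key : ∀ {v : Fin n → ℤ}, x ∈ gridCube h v → ⌊x i / h⌋ = v i := by
    intro v hv
    rw [Int.floor_eq_iff, le_div_iff₀ hh, div_lt_iff₀ hh]
    exact ⟨(hv i).1, by linarith [(hv i).2]⟩
  rw [← key hx, ← key hx']

theorem mem_gridCube_floor {h : ℝ} (hh : 0 < h) (x : EuclideanSpace ℝ (Fin n)) :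
    x ∈ gridCube h fun i => ⌊x i / h⌋ := by
  intro i
  have h1 := (le_div_iff₀ hh).1 (Int.floor_le (x i / h))
  have h2 := (div_lt_iff₀ hh).1 (Int.lt_floor_add_one (x i / h))
  exact ⟨h1, by linarith⟩

theorem exists_finset_gridCube_cover {h : ℝ} (hh : 0 < h) {A : Set (EuclideanSpace ℝ (Fin n))}
    (hA : IsCompact A) : ∃ Z : Finset (Fin n → ℤ), (∀ z ∈ Z, (gridCube h z ∩ A).Nonempty) ∧
      A ⊆ ⋃ z ∈ Z, gridCube h z := by
  have hfin : ((fun (x : EuclideanSpace ℝ (Fin n)) i => ⌊x i / h⌋) '' A).Finite := by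
    obtain ⟨R, hR⟩ := hA.isBounded.exists_norm_le
    refine (Set.Finite.pi' (fun _ : Fin n => Set.finite_Icc (⌊-R / h⌋) (⌊R / h⌋))).subset ?_
    rintro _ ⟨x, hx, rfl⟩ i
    have hxi : |x i| ≤ R := (PiLp.norm_apply_le x i).trans (hR x hx)
    rw [abs_le] at hxi
    exact ⟨Int.floor_le_floor (by gcongr; exact hxi.1), Int.floor_le_floor (by gcongr; exact hxi.2)⟩
  refine ⟨hfin.toFinset, fun z hz => ?_, fun x hx => ?_⟩
  · obtain ⟨x, hx, rfl⟩ := hfin.mem_toFinset.1 hz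
    exact ⟨x, mem_gridCube_floor hh x, hx⟩
  · exact Set.mem_biUnion (hfin.mem_toFinset.2 ⟨x, hx, rfl⟩) (mem_gridCube_floor hh x)

end Cubes

/-! ### Integration against a weight -/

namespace Weight

variable {n : ℕ} (w : Weight n)

theorem aemeasurable_ofReal :
    AEMeasurable (fun x => ENNReal.ofReal (w.toFun x)) volume :=
  w.locallyIntegrable.aestronglyMeasurable.aemeasurable.ennreal_ofReal

theorem integral_measure {F : Type*} [NormedAddCommGroup F] [NormedSpace ℝ F]
    (f : EuclideanSpace ℝ (Fin n) → F) :
    ∫ x, f x ∂w.measure = ∫ x, w.toFun x • f x := by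
  rw [measure, integral_withDensity_eq_integral_toReal_smul₀ w.aemeasurable_ofReal (by simp)]
  simp [ENNReal.toReal_ofReal (w.nonneg _)]

theorem lintegral_measure (f : EuclideanSpace ℝ (Fin n) → ENNReal) :
    ∫⁻ x, f x ∂w.measure = ∫⁻ x, ENNReal.ofReal (w.toFun x) * f x := by
  rw [measure, lintegral_withDensity_eq_lintegral_mul_non_measurable₀ _ w.aemeasurable_ofReal
    (by simp)]
  simp

instance isLocallyFiniteMeasure : IsLocallyFiniteMeasure w.measure := by
  refine ⟨fun x => ?_⟩
  obtain ⟨s, hs, hi⟩ := w.locallyIntegrable x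
  obtain ⟨t, hts, ht, hxt⟩ := _root_.mem_nhds_iff.1 hs
  refine ⟨t, ht.mem_nhds hxt, ?_⟩
  rw [measure, withDensity_apply _ ht.measurableSet]
  exact (hi.mono_set hts).lintegral_lt_top

theorem absolutelyContinuous : w.measure ≪ volume := withDensity_absolutelyContinuous _ _

theorem locallyIntegrable_mul {f : EuclideanSpace ℝ (Fin n) → ℝ}
    (hf : LocallyIntegrable f w.measure) :
    LocallyIntegrable (fun x => w.toFun x * f x) volume := by
  intro x
  obtain ⟨s, hs, hi⟩ := hf x
  obtain ⟨t, hts, ht, hxt⟩ := mem_nhds_iff.1 hs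
  refine ⟨t, ht.mem_nhds hxt, ?_⟩
  have h := hi.mono_set hts
  rw [IntegrableOn, measure, restrict_withDensity ht.measurableSet,
    integrable_withDensity_iff_integrable_smul₀' w.aemeasurable_ofReal.restrict (by simp)] at h
  refine h.congr (Filter.Eventually.of_forall fun y => ?_)
  simp [ENNReal.toReal_ofReal (w.nonneg y)]

theorem memLp_of_hasCompactSupport {F : Type*} [NormedAddCommGroup F]
    {f : EuclideanSpace ℝ (Fin n) → F} (hf : Continuous f) (hc : HasCompactSupport f) :
    MemLp f 2 w.measure :=
  hf.memLp_of_hasCompactSupport hc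

theorem inner_toLp_toLp {F : Type*} [NormedAddCommGroup F] [InnerProductSpace ℝ F]
    {f g : EuclideanSpace ℝ (Fin n) → F} (hf : MemLp f 2 w.measure) (hg : MemLp g 2 w.measure) :
    inner ℝ (hf.toLp f) (hg.toLp g) = ∫ x, w.toFun x * inner ℝ (f x) (g x) := by
  simp_rw [← smul_eq_mul]
  rw [L2.inner_def, ← w.integral_measure fun x => inner ℝ (f x) (g x)]
  refine integral_congr_ae ?_
  filter_upwards [hf.coeFn_toLp, hg.coeFn_toLp] with x h1 h2
  rw [h1, h2]

theorem inner_toLp {F : Type*} [NormedAddCommGroup F] [InnerProductSpace ℝ F]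
    (f : Lp F 2 w.measure) {g : EuclideanSpace ℝ (Fin n) → F} (hg : MemLp g 2 w.measure) :
    inner ℝ f (hg.toLp g) = ∫ x, w.toFun x * inner ℝ (f x) (g x) := by
  conv_lhs => rw [← Lp.toLp_coeFn f (Lp.memLp f)]
  exact w.inner_toLp_toLp _ _

theorem ofReal_norm_sq_toLp {f : EuclideanSpace ℝ (Fin n) → ℝ} (hf : MemLp f 2 w.measure) :
    ENNReal.ofReal (‖hf.toLp f‖ ^ 2) =
      ∫⁻ x, ENNReal.ofReal (w.toFun x) * ENNReal.ofReal (f x ^ 2) := by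
  rw [← real_inner_self_eq_norm_sq, inner_toLp_toLp, ofReal_integral_eq_lintegral_ofReal]
  · refine lintegral_congr fun x => ?_
    rw [ENNReal.ofReal_mul (w.nonneg x), real_inner_self_eq_norm_sq, Real.norm_eq_abs, sq_abs]
  · have h := hf.integrable_norm_rpow (by simp) (by simp)
    rw [measure, integrable_withDensity_iff_integrable_smul₀' w.aemeasurable_ofReal (by simp)] at h
    refine h.congr (Filter.Eventually.of_forall fun x => ?_)
    simp only [ENNReal.toReal_ofReal (w.nonneg x)]
    simp [sq]
  · exact Filter.Eventually.of_forall fun x => mul_nonneg (w.nonneg x) real_inner_self_nonneg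

end Weight

/-! ### Test functions as elements of the weighted `L²` spaces -/

namespace WeightedTest

variable {n : ℕ} {w₀ w₁ : Weight n}

theorem memLp_fn (φ : WeightedTest w₀ w₁) : MemLp φ.fn 2 w₀.measure :=
  w₀.memLp_of_hasCompactSupport φ.contDiff_fn.continuous φ.hasCompactSupport_fn

theorem memLp_gradient (φ : WeightedTest w₀ w₁) : MemLp (gradient φ.fn) 2 w₁.measure :=
  w₁.memLp_of_hasCompactSupport φ.continuous_gradient φ.hasCompactSupport_gradient

/-- The inclusion of test functions into `L²(ω₀)`, as a linear map. -/
def toWeightedL2 (w₀ w₁ : Weight n) : WeightedTest w₀ w₁ →ₗ[ℝ] WeightedL2 w₀ where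
  toFun φ := φ.memLp_fn.toLp φ.fn
  map_add' φ ψ := by
    rw [← MemLp.toLp_add]
    rfl
  map_smul' c φ := by
    rw [RingHom.id_apply, ← MemLp.toLp_const_smul]
    rfl

theorem toWeightedL2_apply (φ : WeightedTest w₀ w₁) :
    toWeightedL2 w₀ w₁ φ = φ.memLp_fn.toLp φ.fn := rfl

/-- The gradient of test functions, as a linear map into the vector-valued space `L²(ω₁)`. -/
def gradL2 (w₀ w₁ : Weight n) :
    WeightedTest w₀ w₁ →ₗ[ℝ] Lp (EuclideanSpace ℝ (Fin n)) 2 w₁.measure where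
  toFun φ := φ.memLp_gradient.toLp (gradient φ.fn)
  map_add' φ ψ := by
    rw [← MemLp.toLp_add]
    exact MemLp.toLp_congr _ _ (Filter.Eventually.of_forall (gradient_add φ ψ))
  map_smul' c φ := by
    rw [RingHom.id_apply, ← MemLp.toLp_const_smul]
    exact MemLp.toLp_congr _ _ (Filter.Eventually.of_forall (gradient_smul c φ))

theorem gradL2_apply (φ : WeightedTest w₀ w₁) :
    gradL2 w₀ w₁ φ = φ.memLp_gradient.toLp (gradient φ.fn) := rfl

/-- The inclusion and the gradient together embed the test functions isometrically into
`L²(ω₀) × L²(ω₁)`. -/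
theorem norm_sq_eq_add (φ : WeightedTest w₀ w₁) :
    ‖φ‖ ^ 2 = ‖toWeightedL2 w₀ w₁ φ‖ ^ 2 + ‖gradL2 w₀ w₁ φ‖ ^ 2 := by
  rw [← real_inner_self_eq_norm_sq (toWeightedL2 w₀ w₁ φ),
    ← real_inner_self_eq_norm_sq (gradL2 w₀ w₁ φ), norm_eq, Real.sq_sqrt]
  · rw [toWeightedL2_apply, gradL2_apply, Weight.inner_toLp_toLp, Weight.inner_toLp_toLp]
    simp only [real_inner_self_eq_norm_sq, Real.norm_eq_abs, sq_abs, mul_comm]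
  · exact add_nonneg (integral_nonneg fun x => mul_nonneg (sq_nonneg _) (w₀.nonneg x))
      (integral_nonneg fun x => mul_nonneg (sq_nonneg _) (w₁.nonneg x))

theorem norm_toWeightedL2_le (φ : WeightedTest w₀ w₁) : ‖toWeightedL2 w₀ w₁ φ‖ ≤ 1 * ‖φ‖ := by
  rw [one_mul]
  refine (sq_le_sq₀ (norm_nonneg _) (norm_nonneg _)).1 ?_
  rw [norm_sq_eq_add φ]
  exact le_add_of_nonneg_right (sq_nonneg _)

theorem norm_gradL2_le (φ : WeightedTest w₀ w₁) : ‖gradL2 w₀ w₁ φ‖ ≤ 1 * ‖φ‖ := by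
  rw [one_mul]
  refine (sq_le_sq₀ (norm_nonneg _) (norm_nonneg _)).1 ?_
  rw [norm_sq_eq_add φ]
  exact le_add_of_nonneg_left (sq_nonneg _)

theorem integral_gradient_sq_le (φ : WeightedTest w₀ w₁) :
    ∫ x, ‖gradient φ.fn x‖ ^ 2 * w₁.toFun x ≤ ‖φ‖ ^ 2 := by
  rw [norm_eq, Real.sq_sqrt]
  · exact le_add_of_nonneg_left
      (integral_nonneg fun x => mul_nonneg (sq_nonneg _) (w₀.nonneg x))
  · exact add_nonneg (integral_nonneg fun x => mul_nonneg (sq_nonneg _) (w₀.nonneg x))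
      (integral_nonneg fun x => mul_nonneg (sq_nonneg _) (w₁.nonneg x))

end WeightedTest

/-! ### The embedding and its injectivity -/

namespace WeightedSobolevZero

open UniformSpace WeightedTest

variable {n : ℕ} (w₀ w₁ : Weight n)

/-- The continuous extension to `W₀^{1,2}(ω₀, ω₁)` of the inclusion of test functions into
`L²(ω₀)`. -/
def toL2 : WeightedSobolevZero w₀ w₁ →L[ℝ] WeightedL2 w₀ :=
  ((toWeightedL2 w₀ w₁).mkContinuous 1 norm_toWeightedL2_le).extend Completion.toComplL

/-- The weak gradient on `W₀^{1,2}(ω₀, ω₁)`: the continuous extension of the gradient of test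
functions. -/
def weakGrad : WeightedSobolevZero w₀ w₁ →L[ℝ] Lp (EuclideanSpace ℝ (Fin n)) 2 w₁.measure :=
  ((gradL2 w₀ w₁).mkContinuous 1 norm_gradL2_le).extend Completion.toComplL

variable {w₀ w₁}

@[simp]
theorem toL2_coe (φ : WeightedTest w₀ w₁) :
    toL2 w₀ w₁ (φ : WeightedSobolevZero w₀ w₁) = toWeightedL2 w₀ w₁ φ :=
  ContinuousLinearMap.extend_eq (e := Completion.toComplL (𝕜 := ℝ)) _ Completion.denseRange_coe
    (Completion.isUniformInducing_coe _) φ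

@[simp]
theorem weakGrad_coe (φ : WeightedTest w₀ w₁) :
    weakGrad w₀ w₁ (φ : WeightedSobolevZero w₀ w₁) = gradL2 w₀ w₁ φ :=
  ContinuousLinearMap.extend_eq (e := Completion.toComplL (𝕜 := ℝ)) _ Completion.denseRange_coe
    (Completion.isUniformInducing_coe _) φ

theorem norm_sq_eq_add (x : WeightedSobolevZero w₀ w₁) :
    ‖x‖ ^ 2 = ‖toL2 w₀ w₁ x‖ ^ 2 + ‖weakGrad w₀ w₁ x‖ ^ 2 := by
  induction x using Completion.induction_on with
  | hp => exact isClosed_eq (by fun_prop) (by fun_prop)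
  | ih φ => rw [toL2_coe, weakGrad_coe, Completion.norm_coe, WeightedTest.norm_sq_eq_add]

theorem continuous_div_of_tsupport_subset {f w : EuclideanSpace ℝ (Fin n) → ℝ}
    {U : Set (EuclideanSpace ℝ (Fin n))} (hU : IsOpen U) (hf : Continuous f)
    (hw : ContinuousOn w U) (hpos : ∀ x ∈ U, 0 < w x) (hfU : tsupport f ⊆ U) :
    Continuous fun x => f x / w x := by
  refine ContinuousOn.continuous_of_tsupport_subset
    (hf.continuousOn.div hw fun x hx => (hpos x hx).ne') hU (subset_trans ?_ hfU)
  exact closure_mono fun x hx h => hx (by simp [h])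

/-- If `x` is sent to `0` in `L²(ω₀)`, its weak gradient vanishes as a distribution on the set `U`
where `ω₁` is positive: integration by parts gives
`⟪∇φ, (η / ω₁) eᵢ⟫ = -⟪φ, ∂ᵢη / ω₀⟫` for test functions `φ`, the inner products being those of
`L²(ω₁)` and `L²(ω₀)`, and both sides are continuous in `φ` for the Sobolev norm. -/
theorem inner_weakGrad_eq {U : Set (EuclideanSpace ℝ (Fin n))} (hU : IsOpen U)
    (hw₀ : Continuous w₀.toFun) (hpos₀ : ∀ x, 0 < w₀.toFun x)
    (hw₁ : ContinuousOn w₁.toFun U) (hpos₁ : ∀ x ∈ U, 0 < w₁.toFun x)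
    {η : EuclideanSpace ℝ (Fin n) → ℝ} (hη : ContDiff ℝ ∞ η) (hc : HasCompactSupport η)
    (hηU : tsupport η ⊆ U) (i : Fin n) (x : WeightedSobolevZero w₀ w₁)
    (hx : toL2 w₀ w₁ x = 0) : ∫ y, η y * weakGrad w₀ w₁ x y i = 0 := by
  set e : EuclideanSpace ℝ (Fin n) := EuclideanSpace.single i 1 with he
  have hc1 : Continuous fun y => (η y / w₁.toFun y) • e :=
    (continuous_div_of_tsupport_subset hU hη.continuous hw₁ hpos₁ hηU).smul continuous_const
  have hs1 : HasCompactSupport fun y => (η y / w₁.toFun y) • e :=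
    hc.mono fun y hy h => hy (by simp [h])
  have hdη : Continuous (fderiv ℝ η) := hη.continuous_fderiv (by simp)
  have hc0 : Continuous fun y => fderiv ℝ η y e / w₀.toFun y :=
    (hdη.clm_apply continuous_const).div hw₀ fun y => (hpos₀ y).ne'
  have hs0 : HasCompactSupport fun y => fderiv ℝ η y e / w₀.toFun y :=
    (hc.fderiv (𝕜 := ℝ)).mono fun y hy h => hy (by simp [h])
  have hm1 := w₁.memLp_of_hasCompactSupport hc1 hs1
  have hm0 := w₀.memLp_of_hasCompactSupport hc0 hs0
  -- Off `U` the quotient `η y / ω₁ y` may be a division by zero, but there `η y = 0`.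
  have hcancel : ∀ y (a : ℝ), w₁.toFun y * (η y / w₁.toFun y * a) = η y * a := by
    intro y a
    by_cases hy : y ∈ U
    · have := (hpos₁ y hy).ne'
      field_simp
    · have : η y = 0 := image_eq_zero_of_notMem_tsupport fun h => hy (hηU h)
      simp [this]
  have key : ∀ z : WeightedSobolevZero w₀ w₁,
      inner ℝ (weakGrad w₀ w₁ z) (hm1.toLp _) = - inner ℝ (toL2 w₀ w₁ z) (hm0.toLp _) := by
    intro z
    induction z using Completion.induction_on with
    | hp => exact isClosed_eq (by fun_prop) (by fun_prop)
    | ih φ =>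
      rw [toL2_coe, weakGrad_coe, toWeightedL2_apply, gradL2_apply, Weight.inner_toLp_toLp,
        Weight.inner_toLp_toLp]
      have h1 : ∀ y, w₁.toFun y * inner ℝ (gradient φ.fn y) ((η y / w₁.toFun y) • e) =
          η y * fderiv ℝ φ.fn y e := by
        intro y
        rw [inner_smul_right, hcancel, inner_gradient_left]
      have h0 : ∀ y, w₀.toFun y * inner ℝ (φ.fn y) (fderiv ℝ η y e / w₀.toFun y) =
          fderiv ℝ η y e * φ.fn y := by
        intro y
        have := (hpos₀ y).ne'
        simp only [RCLike.inner_apply, conj_trivial]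
        field_simp
      simp_rw [h1, h0]
      have hdφ : Continuous (fderiv ℝ φ.fn) := φ.contDiff_fn.continuous_fderiv (by simp)
      have hφc := φ.contDiff_fn.continuous
      have hηc := hη.continuous
      exact integral_mul_fderiv_eq_neg_fderiv_mul_of_integrable
        (((hdη.clm_apply continuous_const).mul hφc).integrable_of_hasCompactSupport
          φ.hasCompactSupport_fn.mul_left)
        ((hηc.mul (hdφ.clm_apply continuous_const)).integrable_of_hasCompactSupport hc.mul_right)
        ((hηc.mul hφc).integrable_of_hasCompactSupport hc.mul_right)
        (fun y _ => hη.differentiable (by simp) y) (fun y _ => φ.differentiable_fn y)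
  have := key x
  rw [hx, inner_zero_left, neg_zero, Weight.inner_toLp] at this
  rw [← this]
  refine integral_congr_ae (Filter.Eventually.of_forall fun y => ?_)
  simp only [inner_smul_right, hcancel, he, EuclideanSpace.inner_single_right]
  simp

/-- Closability of the weighted Dirichlet form: an element of the completion which vanishes in
`L²(ω₀)` has weak gradient `0`, hence norm `0`. -/
theorem toL2_injective {U : Set (EuclideanSpace ℝ (Fin n))} (hU : IsOpen U)
    (hU0 : volume Uᶜ = 0) (hw₀ : Continuous w₀.toFun) (hpos₀ : ∀ x, 0 < w₀.toFun x)
    (hw₁ : ContinuousOn w₁.toFun U) (hpos₁ : ∀ x ∈ U, 0 < w₁.toFun x) :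
    Function.Injective (toL2 w₀ w₁) := by
  rw [injective_iff_map_eq_zero]
  intro x hx
  have hzero : ∀ i, ∀ᵐ y, y ∈ U → weakGrad w₀ w₁ x y i = 0 := by
    intro i
    refine hU.ae_eq_zero_of_integral_contDiff_smul_eq_zero ?_ fun η hη hc hηU =>
      inner_weakGrad_eq hU hw₀ hpos₀ hw₁ hpos₁ hη hc hηU i x hx
    have hmem : MemLp (fun y => weakGrad w₀ w₁ x y i) 2 w₁.measure :=
      (EuclideanSpace.proj (𝕜 := ℝ) i).comp_memLp (weakGrad w₀ w₁ x)
    have hloc : LocallyIntegrable (fun y => weakGrad w₀ w₁ x y i) w₁.measure :=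
      hmem.locallyIntegrable (by norm_num)
    have hloc' := (w₁.locallyIntegrable_mul hloc).locallyIntegrableOn U
    -- Lebesgue integrability near points of `U` comes from dividing by `ω₁`, which is continuous
    -- and nonzero there.
    have h2 : LocallyIntegrableOn
        (fun y => (w₁.toFun y)⁻¹ * (w₁.toFun y * weakGrad w₀ w₁ x y i)) U :=
      hloc'.continuousOn_mul (hw₁.inv₀ fun y hy => (hpos₁ y hy).ne') hU.isLocallyClosed
    intro y hy
    obtain ⟨s, hs, hi⟩ := h2 y hy
    refine ⟨s ∩ U, Filter.inter_mem hs self_mem_nhdsWithin, ?_⟩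
    refine (hi.mono_set Set.inter_subset_left).congr ?_
    have hUm : ∀ᵐ y ∂volume.restrict (s ∩ U), y ∈ U := by
      refine ae_restrict_of_ae ?_
      exact measure_eq_zero_iff_ae_notMem.1 hU0 |>.mono fun y hy => not_not.1 hy
    filter_upwards [hUm] with y hyU
    rw [inv_mul_cancel_left₀ (hpos₁ y hyU).ne']
  have hgrad : weakGrad w₀ w₁ x = 0 := by
    rw [Lp.eq_zero_iff_ae_eq_zero]
    refine w₁.absolutelyContinuous.ae_le ?_
    filter_upwards [ae_all_iff.2 hzero, measure_eq_zero_iff_ae_notMem.1 hU0] with y hy hyU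
    ext i
    exact hy i (not_not.1 hyU)
  have := norm_sq_eq_add x
  rw [hx, hgrad] at this
  simpa using this

end WeightedSobolevZero

/-! ### A compactness criterion -/

/-- An operator into a Hilbert space is compact if, for every `ε > 0`, its values on a dense set lie
within relative distance `ε` of a finite-dimensional subspace `V`: it is then within `ε` of its
composition with the orthogonal projection onto `V`. -/
theorem isCompactOperator_of_approx_finiteDimensional {X₀ X Y : Type*} [NormedAddCommGroup X]
    [NormedSpace ℝ X] [NormedAddCommGroup Y] [InnerProductSpace ℝ Y] [CompleteSpace Y]
    (T : X →L[ℝ] Y) {e : X₀ → X} (he : DenseRange e)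
    (h : ∀ ε > 0, ∃ V : Submodule ℝ Y, FiniteDimensional ℝ V ∧
      ∀ x, ∃ v ∈ V, ‖T (e x) - v‖ ≤ ε * ‖e x‖) :
    IsCompactOperator T := by
  refine (isClosed_setOfPred_isCompactOperator (σ₁₂ := RingHom.id ℝ) (M₁ := X)
    (M₂ := Y)).closure_subset (Metric.mem_closure_iff.2 fun ε hε => ?_)
  obtain ⟨V, hV, happ⟩ := h (ε / 2) (by positivity)
  refine ⟨V.starProjection ∘L T, ?_, ?_⟩
  · have h1 : IsCompactOperator (V.orthogonalProjectionOnto ∘L T) :=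
      isCompactOperator_of_locallyCompactSpace_dom _
    exact h1.clm_comp V.subtypeL
  · rw [dist_eq_norm]
    refine lt_of_le_of_lt (ContinuousLinearMap.opNorm_le_bound _ (by positivity) fun x => ?_)
      (half_lt_self hε)
    induction x using he.induction_on with
    | hp => exact isClosed_le (by fun_prop) (by fun_prop)
    | ih x =>
      obtain ⟨v, hv, hle⟩ := happ x
      refine le_trans ?_ hle
      rw [sub_apply, ContinuousLinearMap.comp_apply, V.starProjection_minimal]
      exact ciInf_le ⟨0, by rintro _ ⟨y, rfl⟩; positivity⟩ (⟨v, hv⟩ : V)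

namespace Weight

variable {n : ℕ} (w : Weight n)

theorem setLIntegral_measure {s : Set (EuclideanSpace ℝ (Fin n))} (hs : MeasurableSet s)
    (f : EuclideanSpace ℝ (Fin n) → ENNReal) :
    ∫⁻ x in s, f x ∂w.measure = ∫⁻ x in s, ENNReal.ofReal (w.toFun x) * f x := by
  rw [measure, setLIntegral_withDensity_eq_setLIntegral_mul_non_measurable₀ _
    w.aemeasurable_ofReal.restrict _ hs (by simp)]
  simp

theorem ofReal_norm_sq_eq_lintegral {f : Lp ℝ 2 w.measure} {g : EuclideanSpace ℝ (Fin n) → ℝ}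
    (hfg : f =ᵐ[w.measure] g) :
    ENNReal.ofReal (‖f‖ ^ 2) = ∫⁻ x, ENNReal.ofReal (g x ^ 2) ∂w.measure := by
  have hg : MemLp g 2 w.measure := (memLp_congr_ae hfg).1 (Lp.memLp f)
  have : f = hg.toLp g := by
    rw [← Lp.toLp_coeFn f (Lp.memLp f)]
    exact MemLp.toLp_congr _ _ hfg
  rw [this, w.ofReal_norm_sq_toLp, lintegral_measure]

/-- The Poincaré inequality on a cube between two weighted norms, when `ω₀ ≤ M` on the part of the
cube in `A` and `ω₁ ≥ c` on the cube. -/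
theorem exists_lintegral_gridCube_inter_le {w₀ w₁ : Weight n}
    {g : EuclideanSpace ℝ (Fin n) → ℝ} (hg : ContDiff ℝ 1 g) {h M c : ℝ} (hh : 0 < h)
    (hM : 0 ≤ M) (hc : 0 < c) {A : Set (EuclideanSpace ℝ (Fin n))} (hA : MeasurableSet A)
    (z : Fin n → ℤ) (hw₀ : ∀ x ∈ A, w₀.toFun x ≤ M) (hw₁ : ∀ x ∈ gridCube h z, c ≤ w₁.toFun x) :
    ∃ a : ℝ, ∫⁻ x in gridCube h z ∩ A, ENNReal.ofReal ((g x - a) ^ 2) ∂w₀.measure ≤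
      ENNReal.ofReal (M * (2 ^ n * (n * h ^ 2)) / c) *
        ∫⁻ x in gridCube h z, ENNReal.ofReal (‖gradient g x‖ ^ 2) ∂w₁.measure := by
  have hQ := measurableSet_gridCube h z
  obtain ⟨a, ha⟩ := exists_lintegral_gridCube_sq_sub_le hg hh z
  refine ⟨a, ?_⟩
  have h1 : ∫⁻ x in gridCube h z ∩ A, ENNReal.ofReal ((g x - a) ^ 2) ∂w₀.measure ≤
      ENNReal.ofReal M * ∫⁻ x in gridCube h z, ENNReal.ofReal ((g x - a) ^ 2) := by
    rw [w₀.setLIntegral_measure (hQ.inter hA), ← lintegral_const_mul' _ _ ENNReal.ofReal_ne_top]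
    refine (setLIntegral_mono' (hQ.inter hA) fun x hx => ?_).trans
      (lintegral_mono_set Set.inter_subset_left)
    gcongr
    exact hw₀ x hx.2
  have h2 : ENNReal.ofReal c * ∫⁻ x in gridCube h z, ENNReal.ofReal (‖gradient g x‖ ^ 2) ≤
      ∫⁻ x in gridCube h z, ENNReal.ofReal (‖gradient g x‖ ^ 2) ∂w₁.measure := by
    rw [w₁.setLIntegral_measure hQ, ← lintegral_const_mul' _ _ ENNReal.ofReal_ne_top]
    refine setLIntegral_mono' hQ fun x hx => ?_
    gcongr
    exact hw₁ x hx
  have hcc : M * (2 ^ n * (n * h ^ 2)) = M * (2 ^ n * (n * h ^ 2)) / c * c := by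
    field_simp
  calc _ ≤ ENNReal.ofReal M * (ENNReal.ofReal (2 ^ n * (n * h ^ 2)) *
        ∫⁻ x in gridCube h z, ENNReal.ofReal (‖gradient g x‖ ^ 2)) := h1.trans (by gcongr)
    _ = ENNReal.ofReal (M * (2 ^ n * (n * h ^ 2)) / c) * (ENNReal.ofReal c *
        ∫⁻ x in gridCube h z, ENNReal.ofReal (‖gradient g x‖ ^ 2)) := by
      rw [← mul_assoc (ENNReal.ofReal M), ← mul_assoc (ENNReal.ofReal _) (ENNReal.ofReal c),
        ← ENNReal.ofReal_mul hM, ← ENNReal.ofReal_mul (by positivity), ← hcc]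
    _ ≤ _ := by gcongr

end Weight

namespace WeightedTest

variable {n : ℕ} {w₀ w₁ : Weight n}

theorem lintegral_gradient_sq_le (φ : WeightedTest w₀ w₁) :
    ∫⁻ x, ENNReal.ofReal (‖gradient φ.fn x‖ ^ 2) ∂w₁.measure ≤ ENNReal.ofReal (‖φ‖ ^ 2) := by
  refine le_trans (le_of_eq ?_) (ENNReal.ofReal_le_ofReal φ.integral_gradient_sq_le)
  rw [w₁.lintegral_measure, ofReal_integral_eq_lintegral_ofReal]
  · refine lintegral_congr fun x => ?_
    rw [mul_comm, ENNReal.ofReal_mul (sq_nonneg _)]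
  · simpa only [real_inner_self_eq_norm_sq] using integrable_right φ φ
  · exact Filter.Eventually.of_forall fun x => mul_nonneg (sq_nonneg _) (w₁.nonneg x)

theorem setLIntegral_fn_sq_eq (φ : WeightedTest w₀ w₁) {s : Set (EuclideanSpace ℝ (Fin n))}
    (hs : MeasurableSet s) :
    ∫⁻ x in s, ENNReal.ofReal (φ.fn x ^ 2) ∂w₀.measure =
      ENNReal.ofReal (∫ x in s, φ.fn x ^ 2 * w₀.toFun x) := by
  rw [w₀.setLIntegral_measure hs, ofReal_integral_eq_lintegral_ofReal]
  · refine lintegral_congr fun x => ?_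
    rw [mul_comm, ENNReal.ofReal_mul (sq_nonneg _)]
  · simpa only [sq] using (integrable_left φ φ).restrict
  · exact Filter.Eventually.of_forall fun x => mul_nonneg (sq_nonneg _) (w₀.nonneg x)

/-- The indicator function of the part of the compact set `A` lying in the cube `gridCube h z`,
as an element of `L²(ω)`. -/
def gridIndicator (w : Weight n) (h : ℝ) {A : Set (EuclideanSpace ℝ (Fin n))} (hA : IsCompact A)
    (z : Fin n → ℤ) : WeightedL2 w :=
  indicatorConstLp 2 (s := gridCube h z ∩ A) ((measurableSet_gridCube h z).inter hA.measurableSet)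
    (measure_ne_top_of_subset Set.inter_subset_right hA.measure_ne_top) 1

theorem gridIndicator_ae_eq (w : Weight n) (h : ℝ) {A : Set (EuclideanSpace ℝ (Fin n))}
    (hA : IsCompact A) (z : Fin n → ℤ) :
    gridIndicator w h hA z =ᵐ[w.measure] (gridCube h z ∩ A).indicator fun _ => (1 : ℝ) :=
  indicatorConstLp_coeFn

/-- Approximation of a test function by a step function on a compact set `A`, covered by cubes on
which `ω₁ ≥ c`: the cubes contribute the error of the Poincaré inequality, and the complement of `A`
contributes `τ`. -/
theorem exists_sum_gridIndicator_close {h M c τ : ℝ} (hh : 0 < h) (hM : 0 ≤ M) (hc : 0 < c)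
    (hτ : 0 ≤ τ)
    {A : Set (EuclideanSpace ℝ (Fin n))} (hA : IsCompact A) (Z : Finset (Fin n → ℤ))
    (hAZ : A ⊆ ⋃ z ∈ Z, gridCube h z) (hw₀ : ∀ x ∈ A, w₀.toFun x ≤ M)
    (hw₁ : ∀ z ∈ Z, ∀ x ∈ gridCube h z, c ≤ w₁.toFun x) (φ : WeightedTest w₀ w₁)
    (htail : ∫ x in Aᶜ, φ.fn x ^ 2 * w₀.toFun x ≤ τ * ‖φ‖ ^ 2) :
    ∃ a : (Fin n → ℤ) → ℝ,
      ‖toWeightedL2 w₀ w₁ φ - ∑ z ∈ Z, a z • gridIndicator w₀ h hA z‖ ^ 2 ≤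
        (M * (2 ^ n * (n * h ^ 2)) / c + τ) * ‖φ‖ ^ 2 := by
  have hg : ContDiff ℝ 1 φ.fn := φ.contDiff_fn.of_le (by simp)
  have hQm := measurableSet_gridCube (n := n) h
  set K := M * (2 ^ n * (n * h ^ 2)) / c with hK
  have hK0 : 0 ≤ K := by positivity
  have hex : ∀ z : Fin n → ℤ, ∃ a : ℝ, z ∈ Z →
      ∫⁻ x in gridCube h z ∩ A, ENNReal.ofReal ((φ.fn x - a) ^ 2) ∂w₀.measure ≤
      ENNReal.ofReal K *
        ∫⁻ x in gridCube h z, ENNReal.ofReal (‖gradient φ.fn x‖ ^ 2) ∂w₁.measure := by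
    intro z
    by_cases hz : z ∈ Z
    · obtain ⟨a, ha⟩ := Weight.exists_lintegral_gridCube_inter_le hg hh hM hc
        hA.measurableSet z hw₀ (hw₁ z hz)
      exact ⟨a, fun _ => ha⟩
    · exact ⟨0, fun h => absurd h hz⟩
  choose a ha using hex
  refine ⟨a, ?_⟩
  set f : EuclideanSpace ℝ (Fin n) → ℝ :=
    fun x => ∑ z ∈ Z, a z * (gridCube h z ∩ A).indicator (fun _ => (1 : ℝ)) x with hf
  have hae : (toWeightedL2 w₀ w₁ φ - ∑ z ∈ Z, a z • gridIndicator w₀ h hA z : WeightedL2 w₀)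
      =ᵐ[w₀.measure] fun x => φ.fn x - f x := by
    have h1 : ∀ z ∈ Z, (a z • gridIndicator w₀ h hA z : WeightedL2 w₀) =ᵐ[w₀.measure]
        fun x => a z * (gridCube h z ∩ A).indicator (fun _ => (1 : ℝ)) x := by
      intro z _
      filter_upwards [Lp.coeFn_smul (a z) (gridIndicator w₀ h hA z),
        gridIndicator_ae_eq w₀ h hA z] with x hx1 hx2
      rw [hx1, Pi.smul_apply, hx2, smul_eq_mul]
    have h2 := (Filter.eventually_all_finset Z).2 h1
    filter_upwards [Lp.coeFn_sub (toWeightedL2 w₀ w₁ φ) (∑ z ∈ Z, a z • gridIndicator w₀ h hA z),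
      Lp.coeFn_fun_finsetSum Z fun z => a z • gridIndicator w₀ h hA z, h2,
      φ.memLp_fn.coeFn_toLp] with x hx1 hx2 hx3 hx4
    rw [hx1, Pi.sub_apply, hx2, Finset.sum_congr rfl hx3, toWeightedL2_apply, hx4]
  have hdisj : Set.PairwiseDisjoint (↑Z) (gridCube (n := n) h) :=
    (pairwise_disjoint_gridCube hh).set_pairwise _
  have hfA : ∀ z ∈ Z, ∀ x ∈ gridCube h z ∩ A, f x = a z := by
    intro z hz x hx
    rw [hf]
    simp only
    rw [Finset.sum_eq_single_of_mem z hz]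
    · simp [Set.indicator_of_mem hx]
    · intro w _ hwz
      have : x ∉ gridCube h w ∩ A := fun hxw =>
        Set.disjoint_left.1 (pairwise_disjoint_gridCube hh hwz) hxw.1 hx.1
      simp [Set.indicator_of_notMem this]
  have hfAc : ∀ x ∈ Aᶜ, f x = 0 := by
    intro x hx
    refine Finset.sum_eq_zero fun z _ => ?_
    rw [Set.indicator_of_notMem fun hxz => hx hxz.2, mul_zero]
  have hin : ∫⁻ x in A, ENNReal.ofReal ((φ.fn x - f x) ^ 2) ∂w₀.measure ≤
      ENNReal.ofReal (K * ‖φ‖ ^ 2) := by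
    have hA' : A = ⋃ z ∈ Z, gridCube h z ∩ A := by
      rw [← Set.iUnion₂_inter, Set.inter_eq_right.2 hAZ]
    calc ∫⁻ x in A, ENNReal.ofReal ((φ.fn x - f x) ^ 2) ∂w₀.measure
        = ∑ z ∈ Z, ∫⁻ x in gridCube h z ∩ A,
            ENNReal.ofReal ((φ.fn x - f x) ^ 2) ∂w₀.measure := by
          conv_lhs => rw [hA']
          exact lintegral_biUnion_finset (hdisj.mono fun z => Set.inter_subset_left)
            (fun z _ => (hQm z).inter hA.measurableSet) _
      _ ≤ ∑ z ∈ Z, ENNReal.ofReal K *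
            ∫⁻ x in gridCube h z, ENNReal.ofReal (‖gradient φ.fn x‖ ^ 2) ∂w₁.measure := by
          refine Finset.sum_le_sum fun z hz => le_trans (le_of_eq ?_) (ha z hz)
          refine setLIntegral_congr_fun ((hQm z).inter hA.measurableSet) fun x hx => ?_
          simp only [hfA z hz x hx]
      _ = ENNReal.ofReal K * ∫⁻ x in ⋃ z ∈ Z, gridCube h z,
            ENNReal.ofReal (‖gradient φ.fn x‖ ^ 2) ∂w₁.measure := by
          rw [← Finset.mul_sum, lintegral_biUnion_finset hdisj fun z _ => hQm z]
      _ ≤ ENNReal.ofReal K * ENNReal.ofReal (‖φ‖ ^ 2) := by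
          gcongr
          exact (setLIntegral_le_lintegral _ _).trans φ.lintegral_gradient_sq_le
      _ = ENNReal.ofReal (K * ‖φ‖ ^ 2) := (ENNReal.ofReal_mul hK0).symm
  have hout : ∫⁻ x in Aᶜ, ENNReal.ofReal ((φ.fn x - f x) ^ 2) ∂w₀.measure ≤
      ENNReal.ofReal (τ * ‖φ‖ ^ 2) := by
    refine le_trans (le_of_eq ?_) (ENNReal.ofReal_le_ofReal htail)
    rw [← φ.setLIntegral_fn_sq_eq hA.measurableSet.compl]
    refine setLIntegral_congr_fun hA.measurableSet.compl fun x hx => ?_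
    simp only [hfAc x hx, sub_zero]
  have htot := w₀.ofReal_norm_sq_eq_lintegral hae
  rw [← lintegral_add_compl _ hA.measurableSet] at htot
  have := htot.trans_le (add_le_add hin hout)
  rw [← ENNReal.ofReal_add (by positivity) (by positivity),
    ENNReal.ofReal_le_ofReal_iff (by positivity)] at this
  linarith

end WeightedTest

namespace WeightedSobolevZero

open UniformSpace WeightedTest

variable {n : ℕ} {w₀ w₁ : Weight n}

/-- The embedding is compact as soon as the `L²(ω₀)` mass of a function of bounded Sobolev norm
outside a suitable compact subset of `{ω₁ > 0}` is uniformly small. -/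
theorem isCompactOperator_toL2 {U : Set (EuclideanSpace ℝ (Fin n))} (hU : IsOpen U)
    (hw₀ : Continuous w₀.toFun) (hw₁ : ContinuousOn w₁.toFun U) (hpos₁ : ∀ x ∈ U, 0 < w₁.toFun x)
    (htail : ∀ τ > 0, ∃ A ⊆ U, IsCompact A ∧ ∀ φ : WeightedTest w₀ w₁,
      ∫ x in Aᶜ, φ.fn x ^ 2 * w₀.toFun x ≤ τ * ‖φ‖ ^ 2) :
    IsCompactOperator (toL2 w₀ w₁) := by
  refine isCompactOperator_of_approx_finiteDimensional _ Completion.denseRange_coe fun ε hε => ?_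
  obtain ⟨A, hAU, hA, htail⟩ := htail (ε ^ 2 / 2) (by positivity)
  obtain ⟨δ, hδ, hδU⟩ := hA.exists_cthickening_subset_open hU hAU
  obtain ⟨c, hc, hcw⟩ := hA.cthickening.exists_forall_le' (hw₁.mono hδU)
    fun x hx => hpos₁ x (hδU hx)
  obtain ⟨M, hM⟩ := hA.exists_bound_of_continuousOn hw₀.continuousOn
  have hM' : ∀ x ∈ A, w₀.toFun x ≤ max M 0 := fun x hx =>
    (le_abs_self _).trans ((hM x hx).trans (le_max_left _ _))
  -- The cubes meeting `A` have to stay in the `δ`-neighbourhood of `A`, where `ω₁ ≥ c`, and the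
  -- Poincaré error has to be at most `ε² / 2`.
  have hh : ∃ h : ℝ, 0 < h ∧ √n * h < δ ∧
      max M 0 * (2 ^ n * (n * h ^ 2)) / c < ε ^ 2 / 2 := by
    have h1 : Filter.Tendsto (fun h : ℝ => √n * h) (nhdsWithin 0 (Set.Ioi 0)) (nhds 0) := by
      have : Continuous fun h : ℝ => √n * h := by fun_prop
      simpa using (this.tendsto 0).mono_left nhdsWithin_le_nhds
    have h2 : Filter.Tendsto (fun h : ℝ => max M 0 * (2 ^ n * (n * h ^ 2)) / c)
        (nhdsWithin 0 (Set.Ioi 0)) (nhds 0) := by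
      have : Continuous fun h : ℝ => max M 0 * (2 ^ n * (n * h ^ 2)) / c := by fun_prop
      simpa using (this.tendsto 0).mono_left nhdsWithin_le_nhds
    have h0 : ∀ᶠ h : ℝ in nhdsWithin 0 (Set.Ioi 0), 0 < h := self_mem_nhdsWithin
    obtain ⟨h, ha, hb, hc⟩ := (h0.and ((h1.eventually_lt_const hδ).and
      (h2.eventually_lt_const (show 0 < ε ^ 2 / 2 by positivity)))).exists
    exact ⟨h, ha, hb, hc⟩
  obtain ⟨h, hh, hhδ, hhε⟩ := hh
  obtain ⟨Z, hZA, hAZ⟩ := exists_finset_gridCube_cover hh hA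
  refine ⟨Submodule.span ℝ (gridIndicator w₀ h hA '' Z),
    FiniteDimensional.span_of_finite ℝ (Z.finite_toSet.image _), fun φ => ?_⟩
  have hw₁c : ∀ z ∈ Z, ∀ x ∈ gridCube h z, c ≤ w₁.toFun x := by
    intro z hz x hx
    obtain ⟨y, hyQ, hyA⟩ := hZA z hz
    exact hcw x (Metric.mem_cthickening_of_dist_le x y δ A hyA
      ((dist_le_of_mem_gridCube hx hyQ).trans hhδ.le))
  obtain ⟨a, ha⟩ := exists_sum_gridIndicator_close hh (le_max_right M 0) hc
    (by positivity : 0 ≤ ε ^ 2 / 2) hA Z hAZ hM' hw₁c φ (htail φ)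
  refine ⟨∑ z ∈ Z, a z • gridIndicator w₀ h hA z, Submodule.sum_mem _ fun z hz =>
    Submodule.smul_mem _ _ (Submodule.subset_span ⟨z, hz, rfl⟩), ?_⟩
  rw [toL2_coe, Completion.norm_coe]
  refine (sq_le_sq₀ (norm_nonneg _) (by positivity)).1 (ha.trans ?_)
  rw [mul_pow]
  gcongr
  linarith

end WeightedSobolevZero

/-! ### A weighted Hardy inequality -/

section Hardy

variable {n : ℕ}

theorem one_add_norm_rpow_pos (θ : ℝ) (x : EuclideanSpace ℝ (Fin n)) : 0 < 1 + ‖x‖ ^ θ := by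
  positivity

/-- The weight `(|x|² + ε) ^ (-θ/2) (1 + |x| ^ θ) ^ (-m)` of the Hardy inequality. As `ε → 0` it
increases to `ω / |x|²`, where `ω = |x| ^ (2-θ) (1 + |x| ^ θ) ^ (-m)` is the weight of the gradient
term; the parameter `ε > 0` makes it of class `C¹` at the origin. -/
def hardyWeight (n : ℕ) (θ m ε : ℝ) (x : EuclideanSpace ℝ (Fin n)) : ℝ :=
  (‖x‖ ^ 2 + ε) ^ (-θ / 2) * (1 + ‖x‖ ^ θ) ^ (-m)

theorem hardyWeight_pos {θ m ε : ℝ} (hε : 0 < ε) (x : EuclideanSpace ℝ (Fin n)) :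
    0 < hardyWeight n θ m ε x := by
  unfold hardyWeight
  positivity

theorem contDiff_hardyWeight {θ m ε : ℝ} (hθ : 1 < θ) (hε : 0 < ε) :
    ContDiff ℝ 1 (hardyWeight n θ m ε) := by
  refine ContDiff.mul ?_ ?_
  · refine ContDiff.rpow_const_of_ne ((contDiff_norm_sq ℝ).add contDiff_const) fun x => ?_
    positivity
  · exact (contDiff_const.add (contDiff_norm_rpow hθ)).rpow_const_of_ne
      fun x => (one_add_norm_rpow_pos θ x).ne'

theorem norm_rpow_sub_two_mul_sq {θ : ℝ} (hθ : 0 < θ) (x : EuclideanSpace ℝ (Fin n)) :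
    ‖x‖ ^ (θ - 2) * ‖x‖ ^ 2 = ‖x‖ ^ θ := by
  rcases eq_or_ne x 0 with rfl | hx
  · simp [Real.zero_rpow hθ.ne']
  · rw [← Real.rpow_natCast ‖x‖ 2, ← Real.rpow_add (norm_pos_iff.2 hx)]
    norm_num

/-- The radial derivative `x · ∇q` of the weight `q = hardyWeight n θ m ε`. -/
theorem fderiv_hardyWeight_apply_self {θ m ε : ℝ} (hθ : 1 < θ) (hε : 0 < ε)
    (x : EuclideanSpace ℝ (Fin n)) :
    fderiv ℝ (hardyWeight n θ m ε) x x = -(hardyWeight n θ m ε x *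
      (θ * (‖x‖ ^ 2 / (‖x‖ ^ 2 + ε)) + m * θ * (‖x‖ ^ θ / (1 + ‖x‖ ^ θ)))) := by
  have hA : 0 < ‖x‖ ^ 2 + ε := by positivity
  have hB := one_add_norm_rpow_pos θ x
  have h1 : HasFDerivAt (fun x : EuclideanSpace ℝ (Fin n) => ‖x‖ ^ 2 + ε)
      ((2 : ℝ) • innerSL ℝ x) x := by
    simpa only [← Nat.cast_smul_eq_nsmul ℝ, Nat.cast_ofNat] using
      (hasStrictFDerivAt_norm_sq x).hasFDerivAt.add_const ε
  have h2 := (hasFDerivAt_norm_rpow x hθ).const_add 1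
  have h3 := (h1.rpow_const (p := -θ / 2) (Or.inl hA.ne')).mul
    (h2.rpow_const (p := -m) (Or.inl hB.ne'))
  have h4 : fderiv ℝ (hardyWeight n θ m ε) x = _ := h3.fderiv
  rw [h4]
  simp only [add_apply, smul_apply, innerSL_apply_apply, smul_eq_mul, real_inner_self_eq_norm_sq,
    hardyWeight]
  rw [Real.rpow_sub_one hA.ne', Real.rpow_sub_one hB.ne', mul_assoc θ, norm_rpow_sub_two_mul_sq
    (by linarith)]
  field_simp
  ring

theorem hardyWeight_mul_norm_sq_le {θ m ε : ℝ} (hθ : 0 ≤ θ) (hε : 0 ≤ ε)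
    (x : EuclideanSpace ℝ (Fin n)) :
    hardyWeight n θ m ε x * ‖x‖ ^ 2 ≤ ‖x‖ ^ (2 - θ) * (1 + ‖x‖ ^ θ) ^ (-m) := by
  have hB := one_add_norm_rpow_pos θ x
  rcases eq_or_ne x 0 with rfl | hx
  · rw [norm_zero]
    simp only [ne_eq, OfNat.ofNat_ne_zero, not_false_eq_true, zero_pow, mul_zero]
    positivity
  have hr := norm_pos_iff.2 hx
  have h1 : (‖x‖ ^ 2 + ε) ^ (-θ / 2) ≤ ‖x‖ ^ (-θ) := by
    have := Real.rpow_le_rpow_of_nonpos (by positivity : 0 < ‖x‖ ^ 2)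
      (le_add_of_nonneg_right hε : ‖x‖ ^ 2 ≤ ‖x‖ ^ 2 + ε) (by linarith : -θ / 2 ≤ 0)
    refine this.trans_eq ?_
    rw [← Real.rpow_natCast ‖x‖ 2, ← Real.rpow_mul hr.le]
    congr 1
    push_cast
    ring
  have h2 : ‖x‖ ^ (2 - θ) = ‖x‖ ^ (-θ) * ‖x‖ ^ 2 := by
    rw [← Real.rpow_natCast ‖x‖ 2, ← Real.rpow_add hr]
    congr 1
    push_cast
    ring
  rw [h2, hardyWeight, mul_right_comm]
  gcongr

/-- A weighted Hardy inequality, with a constant independent of `ε`. It is obtained by integrating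
`div (g² q x) = g² (n q + x · ∇q) + 2 g q x · ∇g`, where `q = hardyWeight n θ m ε` satisfies
`n q + x · ∇q ≥ (n - θ - m θ) q`. -/
theorem integral_sq_mul_hardyWeight_le {θ m ε : ℝ} (hθ : 1 < θ) (hθ2 : θ ≤ 2) (hm : 0 ≤ m)
    (hk : 0 < n - θ - m * θ) (hε : 0 < ε) {g : EuclideanSpace ℝ (Fin n) → ℝ}
    (hg : ContDiff ℝ 1 g) (hc : HasCompactSupport g) :
    ∫ x, g x ^ 2 * hardyWeight n θ m ε x ≤ 4 / (n - θ - m * θ) ^ 2 *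
      ∫ x, ‖gradient g x‖ ^ 2 * (‖x‖ ^ (2 - θ) * (1 + ‖x‖ ^ θ) ^ (-m)) := by
  set k := n - θ - m * θ with hkdef
  set q := hardyWeight n θ m ε with hq
  have hqd : ContDiff ℝ 1 q := contDiff_hardyWeight hθ hε
  have hu : ContDiff ℝ 1 fun x => g x ^ 2 * q x := (hg.pow 2).mul hqd
  have hcu : HasCompactSupport fun x => g x ^ 2 * q x :=
    hc.mono fun x hx h => hx (by simp [h])
  have hfg : Continuous (fderiv ℝ g) := hg.continuous_fderiv (by simp)
  have hgr : Continuous (gradient g) := (LinearIsometryEquiv.continuous _).comp hfg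
  have hgrc : HasCompactSupport (gradient g) := (hc.fderiv (𝕜 := ℝ)).comp_left (map_zero _)
  have hW : Continuous fun x : EuclideanSpace ℝ (Fin n) =>
      ‖x‖ ^ (2 - θ) * (1 + ‖x‖ ^ θ) ^ (-m) :=
    (continuous_norm.rpow_const fun x => Or.inr (by linarith)).mul
      ((continuous_const.add (continuous_norm.rpow_const fun x => Or.inr (by linarith))).rpow_const
        fun x => Or.inl (one_add_norm_rpow_pos θ x).ne')
  have hi1 : Integrable fun x => g x ^ 2 * q x := hu.continuous.integrable_of_hasCompactSupport hcu
  have hi2 : Integrable fun x => fderiv ℝ (fun x => g x ^ 2 * q x) x x :=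
    ((hu.continuous_fderiv (by simp)).clm_apply continuous_id).integrable_of_hasCompactSupport
      ((hcu.fderiv (𝕜 := ℝ)).mono fun x hx h => hx (by simp [h]))
  have hi3 : Integrable fun x => ‖gradient g x‖ ^ 2 * (‖x‖ ^ (2 - θ) * (1 + ‖x‖ ^ θ) ^ (-m)) :=
    ((hgr.norm.pow 2).mul hW).integrable_of_hasCompactSupport
      (hgrc.mono fun x hx h => hx (by simp [h]))
  have heuler := integral_fderiv_apply_self hu hcu
  have hpt : ∀ x, k / 2 * (g x ^ 2 * q x) -
      2 / k * (‖gradient g x‖ ^ 2 * (‖x‖ ^ (2 - θ) * (1 + ‖x‖ ^ θ) ^ (-m))) ≤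
      n * (g x ^ 2 * q x) + fderiv ℝ (fun x => g x ^ 2 * q x) x x := by
    intro x
    have hd : fderiv ℝ (fun x => g x ^ 2 * q x) x x =
        2 * g x * q x * fderiv ℝ g x x + g x ^ 2 * fderiv ℝ q x x := by
      have h1 : HasFDerivAt g (fderiv ℝ g x) x :=
        (hg.differentiable (by simp) x).hasFDerivAt
      have h2 : HasFDerivAt q (fderiv ℝ q x) x :=
        (hqd.differentiable (by simp) x).hasFDerivAt
      have h3 : fderiv ℝ (fun x => g x ^ 2 * q x) x = _ := ((h1.pow 2).mul h2).fderiv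
      rw [h3]
      simp
      ring
    have hq0 : 0 < q x := hardyWeight_pos hε x
    have hB := one_add_norm_rpow_pos θ x
    have hrad : (k - n) * q x ≤ fderiv ℝ q x x := by
      rw [hq, fderiv_hardyWeight_apply_self hθ hε, ← hq]
      have h1 : ‖x‖ ^ 2 / (‖x‖ ^ 2 + ε) ≤ 1 := by
        rw [div_le_one (by positivity)]; linarith
      have h2 : ‖x‖ ^ θ / (1 + ‖x‖ ^ θ) ≤ 1 := by
        rw [div_le_one hB]; linarith
      have h3 : θ * (‖x‖ ^ 2 / (‖x‖ ^ 2 + ε)) + m * θ * (‖x‖ ^ θ / (1 + ‖x‖ ^ θ)) ≤ n - k := by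
        have h4 := mul_le_mul_of_nonneg_left h1 (by linarith : 0 ≤ θ)
        have h5 := mul_le_mul_of_nonneg_left h2 (by positivity : 0 ≤ m * θ)
        linarith
      have := mul_le_mul_of_nonneg_left h3 hq0.le
      linarith
    have hL : |fderiv ℝ g x x| ≤ ‖gradient g x‖ * ‖x‖ := by
      have := (fderiv ℝ g x).le_opNorm x
      unfold gradient
      rwa [LinearIsometryEquiv.norm_map]
    have hLsq : fderiv ℝ g x x ^ 2 * q x ≤
        ‖gradient g x‖ ^ 2 * (‖x‖ ^ (2 - θ) * (1 + ‖x‖ ^ θ) ^ (-m)) := by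
      calc fderiv ℝ g x x ^ 2 * q x ≤ (‖gradient g x‖ * ‖x‖) ^ 2 * q x := by
            rw [← sq_abs]; gcongr
        _ = ‖gradient g x‖ ^ 2 * (q x * ‖x‖ ^ 2) := by ring
        _ ≤ _ := mul_le_mul_of_nonneg_left
            (hardyWeight_mul_norm_sq_le (zero_le_one.trans hθ.le) hε.le x) (sq_nonneg _)
    -- The inequality between arithmetic and geometric means, weighted so that half of the term
    -- `k g² q` is absorbed.
    have hamgm : -(k / 2 * (g x ^ 2 * q x)) - 2 / k * (fderiv ℝ g x x ^ 2 * q x) ≤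
        2 * g x * q x * fderiv ℝ g x x := by
      have : 0 ≤ 2 / k * q x * (k / 2 * g x + fderiv ℝ g x x) ^ 2 := by positivity
      have h6 : 2 / k * q x * (k / 2 * g x + fderiv ℝ g x x) ^ 2 =
          k / 2 * (g x ^ 2 * q x) + 2 * g x * q x * fderiv ℝ g x x +
            2 / k * (fderiv ℝ g x x ^ 2 * q x) := by
        field_simp
        ring
      linarith
    rw [hd]
    have h7 := mul_le_mul_of_nonneg_left hrad (sq_nonneg (g x))
    have h8 := mul_le_mul_of_nonneg_left hLsq (by positivity : 0 ≤ 2 / k)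
    linarith
  have hint := integral_mono ((hi1.const_mul _).sub (hi3.const_mul _))
    ((hi1.const_mul _).add hi2) hpt
  simp only [Pi.sub_apply, Pi.add_apply] at hint
  rw [integral_sub (hi1.const_mul _) (hi3.const_mul _), integral_add (hi1.const_mul _) hi2,
    integral_const_mul, integral_const_mul, integral_const_mul, heuler, add_neg_cancel,
    sub_nonpos] at hint
  have h9 := mul_le_mul_of_nonneg_left hint (by positivity : 0 ≤ 2 / k)
  calc _ = 2 / k * (k / 2 * ∫ x, g x ^ 2 * q x) := by field_simp
    _ ≤ _ := h9
    _ = _ := by rw [← mul_assoc]; congr 1; field_simp; norm_num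

/-- Far from the origin, `(1 + |x| ^ θ) ^ (-m - 2)` is small relative to the Hardy weight with
`ε = 1`. -/
theorem one_add_norm_rpow_neg_le_hardyWeight_outer {θ m R : ℝ} (hθ : 0 ≤ θ) (hθ2 : θ ≤ 2)
    (hR : 0 < R) {x : EuclideanSpace ℝ (Fin n)} (hx : R ≤ ‖x‖) :
    (1 + ‖x‖ ^ θ) ^ (-m - 2) ≤ R ^ (-θ) * hardyWeight n θ m 1 x := by
  have hB := one_add_norm_rpow_pos θ x
  have hr : 0 < ‖x‖ := hR.trans_le hx
  have h1 : (‖x‖ ^ 2 + 1) ^ (θ / 2) ≤ 1 + ‖x‖ ^ θ := by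
    have := Real.rpow_add_le_add_rpow (sq_nonneg ‖x‖) zero_le_one (by linarith : 0 ≤ θ / 2)
      (by linarith : θ / 2 ≤ 1)
    rw [Real.one_rpow, ← Real.rpow_natCast ‖x‖ 2, ← Real.rpow_mul hr.le] at this
    rw [← Real.rpow_natCast ‖x‖ 2]
    refine this.trans_eq ?_
    rw [add_comm]
    congr 2
    push_cast
    ring
  have h2 : R ^ θ ≤ 1 + ‖x‖ ^ θ :=
    (Real.rpow_le_rpow hR.le hx hθ).trans (by linarith)
  have h3 : (1 + ‖x‖ ^ θ) ^ (-m - 2) =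
      (1 + ‖x‖ ^ θ)⁻¹ * ((1 + ‖x‖ ^ θ)⁻¹ * (1 + ‖x‖ ^ θ) ^ (-m)) := by
    rw [Real.rpow_sub hB, Real.rpow_two]
    field_simp
  rw [h3, hardyWeight, Real.rpow_neg hR.le, neg_div,
    Real.rpow_neg (by positivity : 0 ≤ ‖x‖ ^ 2 + 1)]
  gcongr

/-- Near the origin, `(1 + |x| ^ θ) ^ (-m - 2)` is small relative to the Hardy weight with
`ε = δ²`. -/
theorem one_add_norm_rpow_neg_le_hardyWeight_inner {θ m δ : ℝ} (hθ : 0 ≤ θ) (hθ2 : θ ≤ 2)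
    (hδ : 0 < δ) {x : EuclideanSpace ℝ (Fin n)} (hx : ‖x‖ ≤ δ) :
    (1 + ‖x‖ ^ θ) ^ (-m - 2) ≤ 2 * δ ^ θ * hardyWeight n θ m (δ ^ 2) x := by
  have hB := one_add_norm_rpow_pos θ x
  have h1 : (‖x‖ ^ 2 + δ ^ 2) ^ (θ / 2) ≤ 2 * δ ^ θ := by
    have h2 : ‖x‖ ^ 2 + δ ^ 2 ≤ 2 * δ ^ 2 := by
      have : ‖x‖ ^ 2 ≤ δ ^ 2 := by gcongr
      linarith
    refine (Real.rpow_le_rpow (by positivity) h2 (by linarith)).trans ?_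
    rw [Real.mul_rpow (by norm_num) (by positivity), ← Real.rpow_natCast δ 2,
      ← Real.rpow_mul hδ.le]
    have h3 : (2 : ℝ) ^ (θ / 2) ≤ 2 := by
      simpa using Real.rpow_le_rpow_of_exponent_le (by norm_num : (1 : ℝ) ≤ 2)
        (by linarith : θ / 2 ≤ 1)
    have h4 : ((2 : ℕ) : ℝ) * (θ / 2) = θ := by push_cast; ring
    rw [h4]
    gcongr
  have h5 : (1 + ‖x‖ ^ θ) ^ (-m - 2) ≤ (1 + ‖x‖ ^ θ) ^ (-m) :=
    Real.rpow_le_rpow_of_exponent_le (by linarith [Real.rpow_nonneg (norm_nonneg x) θ])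
      (by linarith)
  refine h5.trans ?_
  have hpos : 0 < (‖x‖ ^ 2 + δ ^ 2) ^ (θ / 2) := by positivity
  have h6 : 1 ≤ 2 * δ ^ θ * (‖x‖ ^ 2 + δ ^ 2) ^ (-θ / 2) := by
    rw [neg_div, Real.rpow_neg (by positivity : 0 ≤ ‖x‖ ^ 2 + δ ^ 2), ← div_eq_mul_inv,
      one_le_div hpos]
    exact h1
  rw [hardyWeight, ← mul_assoc]
  exact le_mul_of_one_le_left (by positivity) h6

end Hardy

/-! ### The weights built from `v` -/

section Bubble

variable {n : ℕ} {p : ℝ}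

theorem bubbleConst_pos (hp : 2 ≤ p) (hpn : p < n) : 0 < bubbleConst n p := by
  refine lt_of_le_of_ne (bubbleConst_nonneg n p) fun h => ?_
  have h1 := eLpNorm_bubble hp hpn
  have h2 : bubble n p = 0 := by
    funext x
    simp [bubble, ← h]
  rw [h2, eLpNorm_zero] at h1
  exact zero_ne_one h1

theorem bubbleProfile_eq_rpow (x : EuclideanSpace ℝ (Fin n)) :
    bubbleProfile n p x = (1 + ‖x‖ ^ conjExp p) ^ (-((n - p) / p)) := by
  rw [bubbleProfile, one_div, Real.rpow_neg (one_add_norm_rpow_pos _ x).le]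

/-- The weight `v ^ (p* - 2)` is a multiple of `(1 + |x| ^ p') ^ (-m - 2)` with
`m = n (p - 2) / p`. -/
theorem bubbleWeight_eq (hp : 2 ≤ p) (hpn : p < n) : ∃ C > 0, ∀ x,
    (bubbleWeight hp hpn).toFun x =
      C * (1 + ‖x‖ ^ conjExp p) ^ (-(n * (p - 2) / p) - 2) := by
  refine ⟨bubbleConst n p ^ (sobolevExp n p - 2),
    Real.rpow_pos_of_pos (bubbleConst_pos hp hpn) _, fun x => ?_⟩
  have hB := one_add_norm_rpow_pos (conjExp p) x
  change bubble n p x ^ (sobolevExp n p - 2) = _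
  rw [bubble, Real.mul_rpow (bubbleConst_nonneg n p) (bubbleProfile_pos n p x).le,
    bubbleProfile_eq_rpow, ← Real.rpow_mul hB.le]
  congr 2
  have h1 : (n : ℝ) - p ≠ 0 := by linarith
  have h2 : p ≠ 0 := by linarith
  unfold sobolevExp
  field_simp
  ring

theorem norm_gradient_bubble (hp : 2 ≤ p) (hpn : p < n) (x : EuclideanSpace ℝ (Fin n)) :
    ‖gradient (bubble n p) x‖ = bubbleConst n p * ((n - p) / p) * conjExp p *
      (‖x‖ ^ (conjExp p - 1) * (1 + ‖x‖ ^ conjExp p) ^ (-(n / p))) := by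
  have hθ := one_lt_conjExp hp
  have hB := one_add_norm_rpow_pos (conjExp p) x
  have hα : 0 < (n - p) / p := div_pos (by linarith) (by linarith)
  have hb : bubble n p = fun x => bubbleConst n p *
      (1 + ‖x‖ ^ conjExp p) ^ (-((n - p) / p)) := by
    funext x
    rw [bubble, bubbleProfile_eq_rpow]
  have h1 := (((hasFDerivAt_norm_rpow x hθ).const_add 1).rpow_const
    (p := -((n - p) / p)) (Or.inl hB.ne')).const_mul (bubbleConst n p)
  unfold gradient
  rw [LinearIsometryEquiv.norm_map, hb, h1.fderiv]
  have hr : ‖x‖ ^ (conjExp p - 2) * ‖x‖ = ‖x‖ ^ (conjExp p - 1) := by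
    rcases eq_or_ne x 0 with rfl | hx
    · simp [Real.zero_rpow (by linarith : conjExp p - 1 ≠ 0)]
    · rw [← Real.rpow_add_one (norm_pos_iff.2 hx).ne']
      congr 1
      ring
  have he : -((n - p) / p) - 1 = -(n / p : ℝ) := by
    have h2 : p ≠ 0 := by linarith
    field_simp
    ring
  simp only [norm_smul, innerSL_apply_norm, he, Real.norm_eq_abs, abs_mul, abs_neg,
    abs_of_nonneg (bubbleConst_nonneg n p), abs_of_pos hα,
    abs_of_pos (by linarith : 0 < conjExp p), Real.abs_rpow_of_nonneg (norm_nonneg x), abs_norm,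
    abs_of_pos (Real.rpow_pos_of_pos hB (-(n / p)))]
  rw [← hr]
  ring

/-- The weight `|∇v| ^ (p - 2)` is a multiple of `|x| ^ (2 - p') (1 + |x| ^ p') ^ (-m)` with
`m = n (p - 2) / p`. For `p = 2` both factors are `1`, including at the origin. -/
theorem bubbleGradWeight_eq (hp : 2 ≤ p) (hpn : p < n) : ∃ C > 0, ∀ x,
    (bubbleGradWeight (n := n) hp).toFun x = C *
      (‖x‖ ^ (2 - conjExp p) * (1 + ‖x‖ ^ conjExp p) ^ (-(n * (p - 2) / p))) := by
  have hθ := one_lt_conjExp hp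
  have hα : 0 < (n - p) / p := div_pos (by linarith) (by linarith)
  have hC : 0 < bubbleConst n p * ((n - p) / p) * conjExp p :=
    mul_pos (mul_pos (bubbleConst_pos hp hpn) hα) (by linarith)
  refine ⟨(bubbleConst n p * ((n - p) / p) * conjExp p) ^ (p - 2),
    Real.rpow_pos_of_pos hC _, fun x => ?_⟩
  have hB := one_add_norm_rpow_pos (conjExp p) x
  change ‖gradient (bubble n p) x‖ ^ (p - 2) = _
  rw [norm_gradient_bubble hp hpn]
  generalize bubbleConst n p * ((n - p) / p) * conjExp p = C at hC ⊢
  rw [Real.mul_rpow hC.le (by positivity),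
    Real.mul_rpow (by positivity) (by positivity), ← Real.rpow_mul (norm_nonneg x),
    ← Real.rpow_mul hB.le]
  have hp1 : p - 1 ≠ 0 := by linarith
  have h2 : p ≠ 0 := by linarith
  congr 3
  · unfold conjExp
    field_simp
    ring
  · field_simp

/-- Uniform smallness of the tails: the part of `∫ φ² v ^ (p* - 2)` outside the annulus
`δ ≤ |x| ≤ 1 / δ` is at most a constant times `δ ^ p' ∫ |∇φ|² |∇v| ^ (p - 2)`. -/
theorem exists_tail_le (hp : 2 ≤ p) (hpn : p < n) {τ : ℝ} (hτ : 0 < τ) :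
    ∃ A ⊆ ({0}ᶜ : Set (EuclideanSpace ℝ (Fin n))), IsCompact A ∧
      ∀ φ : WeightedTest (bubbleWeight hp hpn) (bubbleGradWeight (n := n) hp),
        ∫ x in Aᶜ, φ.fn x ^ 2 * (bubbleWeight hp hpn).toFun x ≤ τ * ‖φ‖ ^ 2 := by
  obtain ⟨C₀, hC₀, h₀⟩ := bubbleWeight_eq hp hpn
  obtain ⟨C₁, hC₁, h₁⟩ := bubbleGradWeight_eq hp hpn
  have hθ := one_lt_conjExp hp
  have hp1 : 0 < p - 1 := by linarith
  have hp0 : 0 < p := by linarith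
  have hθ2 : conjExp p ≤ 2 := by
    unfold conjExp
    rw [div_le_iff₀ hp1]
    linarith
  set θ := conjExp p with hθdef
  set m : ℝ := n * (p - 2) / p with hm
  have hm0 : 0 ≤ m := div_nonneg (mul_nonneg (by positivity) (by linarith)) hp0.le
  have hk : 0 < n - θ - m * θ := by
    -- This is where `p < n` enters: the Hardy constant is positive.
    have : n - θ - m * θ = (n - p) / (p - 1) := by
      rw [hm, hθdef, conjExp]
      field_simp
      ring
    rw [this]
    exact div_pos (by linarith) hp1
  set k := n - θ - m * θ with hkdef
  obtain ⟨δ, hδ, hδτ⟩ : ∃ δ : ℝ, 0 < δ ∧ 3 * C₀ * (4 / k ^ 2 / C₁) * δ ^ θ < τ := by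
    have hcont : Continuous fun δ : ℝ => 3 * C₀ * (4 / k ^ 2 / C₁) * δ ^ θ :=
      continuous_const.mul (continuous_id.rpow_const fun x => Or.inr (by linarith))
    have ht := (hcont.tendsto 0).mono_left (nhdsWithin_le_nhds (s := Set.Ioi 0))
    rw [Real.zero_rpow (by linarith), mul_zero] at ht
    have hpos : ∀ᶠ δ : ℝ in nhdsWithin 0 (Set.Ioi 0), 0 < δ := self_mem_nhdsWithin
    exact (hpos.and (ht.eventually_lt_const hτ)).exists
  refine ⟨Metric.closedBall 0 δ⁻¹ \ Metric.ball 0 δ, ?_,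
    (isCompact_closedBall _ _).diff Metric.isOpen_ball, fun φ => ?_⟩
  · rintro x hx rfl
    exact hx.2 (Metric.mem_ball_self hδ)
  have hg : ContDiff ℝ 1 φ.fn := φ.contDiff_fn.of_le (by simp)
  set G := ∫ x, ‖gradient φ.fn x‖ ^ 2 * (bubbleGradWeight (n := n) hp).toFun x with hG
  have hhardy : ∀ ε > 0, ∫ x, φ.fn x ^ 2 * hardyWeight n θ m ε x ≤ 4 / k ^ 2 / C₁ * G := by
    intro ε hε
    refine (integral_sq_mul_hardyWeight_le hθ hθ2 hm0 hk hε hg φ.hasCompactSupport_fn).trans_eq ?_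
    have : G = C₁ * ∫ x, ‖gradient φ.fn x‖ ^ 2 * (‖x‖ ^ (2 - θ) * (1 + ‖x‖ ^ θ) ^ (-m)) := by
      rw [hG, ← integral_const_mul]
      refine integral_congr_ae (Filter.Eventually.of_forall fun x => ?_)
      simp only [h₁]
      ring
    rw [this, ← hkdef, ← mul_assoc, div_mul_cancel₀ _ hC₁.ne']
  have hint : ∀ ε > 0, Integrable fun x => φ.fn x ^ 2 * hardyWeight n θ m ε x := fun ε hε =>
    ((hg.continuous.pow 2).mul (contDiff_hardyWeight hθ hε).continuous)
      |>.integrable_of_hasCompactSupport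
        (φ.hasCompactSupport_fn.mono fun x hx h => hx (by simp [h]))
  set F : EuclideanSpace ℝ (Fin n) → ℝ := fun x =>
    C₀ * (2 * δ ^ θ) * (φ.fn x ^ 2 * hardyWeight n θ m (δ ^ 2) x) +
      C₀ * δ ^ θ * (φ.fn x ^ 2 * hardyWeight n θ m 1 x) with hF
  have hFint : Integrable F :=
    ((hint (δ ^ 2) (by positivity)).const_mul _).add ((hint 1 one_pos).const_mul _)
  have hF1 : ∀ x, 0 ≤ C₀ * (2 * δ ^ θ) * (φ.fn x ^ 2 * hardyWeight n θ m (δ ^ 2) x) := fun x => by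
    have := hardyWeight_pos (n := n) (θ := θ) (m := m) (by positivity : 0 < δ ^ 2) x
    positivity
  have hF2 : ∀ x, 0 ≤ C₀ * δ ^ θ * (φ.fn x ^ 2 * hardyWeight n θ m 1 x) := fun x => by
    have := hardyWeight_pos (n := n) (θ := θ) (m := m) one_pos x
    positivity
  have hpt : ∀ x ∈ (Metric.closedBall (0 : EuclideanSpace ℝ (Fin n)) δ⁻¹ \ Metric.ball 0 δ)ᶜ,
      φ.fn x ^ 2 * (bubbleWeight hp hpn).toFun x ≤ F x := by
    intro x hx
    have hx' : ‖x‖ ≤ δ ∨ δ⁻¹ ≤ ‖x‖ := by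
      by_contra! hcon
      exact hx ⟨by simpa using hcon.2.le, by simpa using hcon.1.le⟩
    rw [h₀]
    rcases hx' with hx' | hx'
    · have h2 := mul_le_mul_of_nonneg_left
        (one_add_norm_rpow_neg_le_hardyWeight_inner (m := m) (by linarith) hθ2 hδ hx')
        (by positivity : 0 ≤ φ.fn x ^ 2 * C₀)
      have := hF2 x
      simp only [hF]
      linarith
    · have h2 := mul_le_mul_of_nonneg_left
        (one_add_norm_rpow_neg_le_hardyWeight_outer (m := m) (by linarith) hθ2
          (inv_pos.2 hδ) hx')
        (by positivity : 0 ≤ φ.fn x ^ 2 * C₀)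
      rw [Real.inv_rpow hδ.le, Real.rpow_neg hδ.le, inv_inv] at h2
      have := hF1 x
      simp only [hF]
      linarith
  have hA : MeasurableSet
      (Metric.closedBall (0 : EuclideanSpace ℝ (Fin n)) δ⁻¹ \ Metric.ball 0 δ)ᶜ :=
    (measurableSet_closedBall.diff measurableSet_ball).compl
  have hL := WeightedTest.integrable_left φ φ
  simp only [← sq] at hL
  have hGle : G ≤ ‖φ‖ ^ 2 := φ.integral_gradient_sq_le
  calc _ ≤ ∫ x in (Metric.closedBall (0 : EuclideanSpace ℝ (Fin n)) δ⁻¹ \ Metric.ball 0 δ)ᶜ, F x :=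
        setIntegral_mono_on hL.integrableOn hFint.integrableOn hA hpt
    _ ≤ ∫ x, F x := setIntegral_le_integral hFint
        (Filter.Eventually.of_forall fun x => add_nonneg (hF1 x) (hF2 x))
    _ = C₀ * (2 * δ ^ θ) * (∫ x, φ.fn x ^ 2 * hardyWeight n θ m (δ ^ 2) x) +
          C₀ * δ ^ θ * ∫ x, φ.fn x ^ 2 * hardyWeight n θ m 1 x := by
        rw [hF, integral_add ((hint (δ ^ 2) (by positivity)).const_mul _)
          ((hint 1 one_pos).const_mul _), integral_const_mul, integral_const_mul]
    _ ≤ C₀ * (2 * δ ^ θ) * (4 / k ^ 2 / C₁ * G) + C₀ * δ ^ θ * (4 / k ^ 2 / C₁ * G) := by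
        gcongr
        · exact hhardy _ (by positivity)
        · exact hhardy _ one_pos
    _ = 3 * C₀ * (4 / k ^ 2 / C₁) * δ ^ θ * G := by ring
    _ ≤ 3 * C₀ * (4 / k ^ 2 / C₁) * δ ^ θ * ‖φ‖ ^ 2 := by gcongr
    _ ≤ τ * ‖φ‖ ^ 2 := by gcongr

end Bubble

end

/-- The space `X = W₀^{1,2}(ℝⁿ, v^{p*-2}, |∇v|^{p-2})` embeds compactly into `L²(ℝⁿ, v^{p*-2})`:
the inclusion of test functions extends to a continuous linear map on the completion `X`, and this
extension is injective and compact. -/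
theorem corollary6p2 (n : ℕ) (p : ℝ) (hp : 2 ≤ p) (hpn : p < n) :
    ∃ ι : WeightedSobolevZero (bubbleWeight hp hpn) (bubbleGradWeight (n := n) hp) →L[ℝ]
        WeightedL2 (bubbleWeight hp hpn),
      (∀ φ : WeightedTest (bubbleWeight hp hpn) (bubbleGradWeight (n := n) hp),
        ι (φ : WeightedSobolevZero (bubbleWeight hp hpn) (bubbleGradWeight (n := n) hp))
          =ᵐ[(bubbleWeight hp hpn).measure] φ.fn) ∧
      Function.Injective ι ∧
      IsCompactOperator ι := by
  have hn : 0 < n := by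
    have : (0 : ℝ) < n := by linarith
    exact_mod_cast this
  have : Nonempty (Fin n) := ⟨⟨0, hn⟩⟩
  have hU : IsOpen ({0}ᶜ : Set (EuclideanSpace ℝ (Fin n))) := isOpen_compl_singleton
  have hw₀ : Continuous (bubbleWeight hp hpn).toFun :=
    (contDiff_bubble hp).continuous.rpow_const fun _ =>
      Or.inr (by linarith [two_le_sobolevExp hp hpn])
  have hpos₀ : ∀ x, 0 < (bubbleWeight hp hpn).toFun x := fun x =>
    Real.rpow_pos_of_pos (mul_pos (bubbleConst_pos hp hpn) (bubbleProfile_pos n p x)) _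
  have hw₁ : Continuous (bubbleGradWeight (n := n) hp).toFun := by
    have h : Continuous (gradient (bubble n p)) :=
      (LinearIsometryEquiv.continuous _).comp ((contDiff_bubble hp).continuous_fderiv (by simp))
    exact h.norm.rpow_const fun _ => Or.inr (by linarith)
  have hpos₁ : ∀ x ∈ ({0}ᶜ : Set (EuclideanSpace ℝ (Fin n))),
      0 < (bubbleGradWeight (n := n) hp).toFun x := by
    intro x hx
    obtain ⟨C, hC, h⟩ := bubbleGradWeight_eq hp hpn
    have hr : 0 < ‖x‖ := norm_pos_iff.2 hx
    rw [h]
    positivity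
  refine ⟨WeightedSobolevZero.toL2 _ _, fun φ => ?_,
    WeightedSobolevZero.toL2_injective hU (by simp) hw₀ hpos₀ hw₁.continuousOn hpos₁,
    WeightedSobolevZero.isCompactOperator_toL2 hU hw₀ hw₁.continuousOn hpos₁
      fun τ hτ => exists_tail_le hp hpn hτ⟩
  rw [WeightedSobolevZero.toL2_coe]
  exact φ.memLp_fn.coeFn_toLp
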